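/- **Models.** A distributed graph problem is a set of triples $(G,x,y)$, where $G$ is a finite simple graph, $x$ assigns an input and $y$ an output to each node, possibly posed only on a given family of instances $(G,x)$. Nodes know the number $N$ of nodes of $G$ and have unique identifiers in $\{1,\dots,N^{a}\}$, where $a$ is an arbitrary constant known to the algorithm. In the LOCAL model, the nodes compute in synchronous rounds; in each round every node exchanges messages of arbitrary size with its neighbours and performs arbitrary internal computation. In the SLOCAL model with locality $r$, the nodes are processed one by one in an arbitrary (adversarial) order; when a node is processed, it sees its $r$-hop neighbourhood with all identifiers, inputs and current states in it, and computes its new state and its output as an arbitrary function of this. P-LOCAL (P-SLOCAL) is the class of problems that have, for each $a$, a deterministic LOCAL algorithm with $\log^{O(1)}N$ rounds (a deterministic SLOCAL algorithm with locality $\log^{O(1)}N$). A problem $P$ is P-SLOCAL-complete if $P\in$ P-SLOCAL and every $P'\in$ P-SLOCAL is polylog-reducible to $P$, i.e. $P\in$ P-LOCAL implies $P'\in$ P-LOCAL. **Problem.** Let $\varepsilon>0$, let $d\ge 1$ be an integer and let $q:\mathbb N\to\mathbb N$. In the problem $\mathrm{CF}(\varepsilon,d,q)$, the instance is a hypergraph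 $H=(V,E)$ with $n=|V|$ vertices and $|E|\le n^{d}$ hyperedges, which is almost uniform: there is an integer $k\ge1$ with $k\le|e|\le(1+\varepsilon)k$ for all $e\in E$. The network is the bipartite incidence graph of $H$, with one node for each vertex and one for each hyperedge, each node knowing which kind it is. The task is to find a conflict-free multicolouring of $H$ with $q(n)$ colours: each $v\in V$ receives a nonempty set $\phi(v)\subseteq\{1,\dots,q(n)\}$ such that for each $e\in E$ there is a colour $c$ with $|\{v\in e : c\in\phi(v)\}|=1$. **Theorem.** For every $\varepsilon>0$ and every integer $d\ge1$ there is a constant $C$ such that for every function $q:\mathbb N\to\mathbb N$ with $q(n)\ge C(\lfloor\log_2 n\rfloor+1)$ for all $n\geq 1$, $q(0)\ge C$, and $q(n)=\log^{O(1)}n$ (meaning $q(n)\le c(\lfloor\log_2 n\rfloor+1)^c$ for all $n\ge1$ and $q(0)\le c$, for some constant $c$), the problem $\mathrm{CF}(\varepsilon,d,q)$ is P-SLOCAL-complete. -/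

import Mathlib

namespace Distrib

/-- `f n = log^{O(1)} n`. (The `+ 1` only serves the finitely many `n` with `log n` close to `0`.) -/
def IsPolylog (f : ℕ → ℕ) : Prop :=
  ∃ c : ℕ, ∀ n, f n ≤ c * (Nat.log 2 n + 1) ^ c

/-- A distributed graph problem with input labels in `I` and output labels in `O`: a set of triples
`(G, x, y)`, where `G` is a finite simple graph, `x` assigns an input and `y` an output to each node.
`dom` singles out the instances `(G, x)` on which the problem is posed, and `sol G x y` says that `y`
is a correct output for `(G, x)`. -/
structure GraphProblem (I O : Type) where
  dom : ∀ {V : Type} [Fintype V], SimpleGraph V → (V → I) → Prop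
  sol : ∀ {V : Type} [Fintype V], SimpleGraph V → (V → I) → (V → O) → Prop

/-- A network with node set `V`: the communication graph, the identifiers and the inputs. -/
structure Network (V I : Type) where
  graph : SimpleGraph V
  ident : V → ℕ
  input : V → I

/-- The identifiers are unique and come from `{1, …, n ^ a}`, where `n` is the number of nodes. -/
def Network.IdsOK {V I : Type} [Fintype V] (N : Network V I) (a : ℕ) : Prop :=
  Function.Injective N.ident ∧ ∀ v, 1 ≤ N.ident v ∧ N.ident v ≤ Fintype.card V ^ a

/-! ### The LOCAL model -/

/-- A deterministic algorithm of the LOCAL model. Initially a node knows the number `n` of nodes, its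
own identifier and its input. In each synchronous round it sends a message of arbitrary size to each
neighbour (`send s j` goes to the neighbour with identifier `j`), receives the messages of its
neighbours (as pairs of the sender's identifier and the message) and updates its state by an
arbitrary function. After `rounds n` rounds it outputs `out s`. -/
structure LocalAlg (I O : Type) where
  State : Type
  Msg : Type
  rounds : ℕ → ℕ
  init : (n : ℕ) → (ident : ℕ) → (input : I) → State
  send : State → ℕ → Msg
  step : State → Set (ℕ × Msg) → State
  out : State → O

/-- The state of each node after `t` rounds. -/
def LocalAlg.stateAfter {V I O : Type} [Fintype V] (A : LocalAlg I O) (N : Network V I) :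
    ℕ → V → A.State
  | 0, v => A.init (Fintype.card V) (N.ident v) (N.input v)
  | t + 1, v =>
      A.step (A.stateAfter N t v)
        {p | ∃ u, N.graph.Adj v u ∧ p = (N.ident u, A.send (A.stateAfter N t u) (N.ident v))}

/-- The output of each node. -/
def LocalAlg.output {V I O : Type} [Fintype V] (A : LocalAlg I O) (N : Network V I) (v : V) : O :=
  A.out (A.stateAfter N (A.rounds (Fintype.card V)) v)

/-- `A` solves `P` on all networks whose identifiers are unique and lie in `{1, …, n ^ a}`. -/
def LocalAlg.Solves {I O : Type} (A : LocalAlg I O) (P : GraphProblem I O) (a : ℕ) : Prop :=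
  ∀ {V : Type} [Fintype V] (N : Network V I), N.IdsOK a → P.dom N.graph N.input →
    P.sol N.graph N.input (A.output N)

/-- The class P-LOCAL: for every polynomial identifier space, the problem has a deterministic LOCAL
algorithm with polylogarithmically many rounds. -/
def PLocal {I O : Type} (P : GraphProblem I O) : Prop :=
  ∀ a : ℕ, ∃ A : LocalAlg I O, IsPolylog A.rounds ∧ A.Solves P a

/-! ### The SLOCAL model -/

/-- What a node sees of its neighbourhood: its own identifier, the identifier, input and current state
of each node of the neighbourhood (the state is `none` for a node that has not been processed), and
the edges inside the neighbourhood. -/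
structure View (I S : Type) where
  center : ℕ
  nodes : Set (ℕ × I × Option S)
  edges : Set (ℕ × ℕ)

/-- The view of the `r`-hop neighbourhood of `v` when the current states are `s`. -/
def Network.view {V I S : Type} (N : Network V I) (r : ℕ) (s : V → Option S) (v : V) : View I S where
  center := N.ident v
  nodes := {p | ∃ u, N.graph.edist v u ≤ r ∧ p = (N.ident u, N.input u, s u)}
  edges := {p | ∃ u w, N.graph.edist v u ≤ r ∧ N.graph.edist v w ≤ r ∧ N.graph.Adj u w ∧
    p = (N.ident u, N.ident w)}

/-- A deterministic algorithm of the SLOCAL model with locality `locality n` on `n`-node networks.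
When a node is processed, its new state is an arbitrary function of `n` and of the current view of its
`locality n`-hop neighbourhood; its output is part of its state. -/
structure SLocalAlg (I O : Type) where
  State : Type
  locality : ℕ → ℕ
  process : (n : ℕ) → View I State → State
  out : State → O

open Classical in
/-- The states after the nodes in the list have been processed one by one, in the order of the list,
starting from the states `s`. -/
noncomputable def SLocalAlg.runFrom {V I O : Type} [Fintype V] (A : SLocalAlg I O)
    (N : Network V I) : (V → Option A.State) → List V → (V → Option A.State)
  | s, [] => s
  | s, v :: l =>
      A.runFrom N
        (Function.update s v
          (some (A.process (Fintype.card V) (N.view (A.locality (Fintype.card V)) s v)))) l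

/-- `A` solves `P` on all networks whose identifiers are unique and lie in `{1, …, n ^ a}`, for every
order `l` in which the nodes may be processed. -/
def SLocalAlg.Solves {I O : Type} (A : SLocalAlg I O) (P : GraphProblem I O) (a : ℕ) : Prop :=
  ∀ {V : Type} [Fintype V] (N : Network V I), N.IdsOK a → P.dom N.graph N.input →
    ∀ l : List V, l.Nodup → (∀ v, v ∈ l) →
      ∃ y : V → O, (∀ v, (A.runFrom N (fun _ => none) l v).map A.out = some (y v)) ∧
        P.sol N.graph N.input y

/-- The class P-SLOCAL: for every polynomial identifier space, the problem has a deterministic SLOCAL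
algorithm with polylogarithmic locality. -/
def PSLocal {I O : Type} (P : GraphProblem I O) : Prop :=
  ∀ a : ℕ, ∃ A : SLocalAlg I O, IsPolylog A.locality ∧ A.Solves P a

/-! ### Completeness -/

/-- `P₁` is polylog-reducible to `P₂`: a polylog-time deterministic LOCAL algorithm for `P₂` implies
one for `P₁`. -/
def PolylogReducible {I₁ O₁ I₂ O₂ : Type} (P₁ : GraphProblem I₁ O₁) (P₂ : GraphProblem I₂ O₂) :
    Prop :=
  PLocal P₂ → PLocal P₁

/-- `P` is P-SLOCAL-complete. -/
def PSLocalComplete {I O : Type} (P : GraphProblem I O) : Prop :=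
  PSLocal P ∧ ∀ {I' O' : Type} (P' : GraphProblem I' O'), PSLocal P' → PolylogReducible P' P

/-! ### Conflict-free multicolouring -/

/-- All hyperedge sizes lie between `k` and `(1 + ε) k`, for some `k ≥ 1`. -/
def AlmostUniform {W : Type} (ε : ℝ) (H : Hypergraph W) : Prop :=
  ∃ k : ℕ, 1 ≤ k ∧ ∀ e ∈ H.edgeSet, k ≤ e.ncard ∧ (e.ncard : ℝ) ≤ (1 + ε) * k

/-- `φ` is a conflict-free multicolouring of `H` with colours `1, …, q`: each vertex has a nonempty
set of colours, and for each hyperedge `e` some colour is held by exactly one vertex of `e`. -/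
def ConflictFreeMulticolouring {W : Type} (H : Hypergraph W) (q : ℕ) (φ : W → Finset ℕ) : Prop :=
  (∀ v ∈ H.vertexSet, (φ v).Nonempty ∧ φ v ⊆ Finset.Icc 1 q) ∧
    ∀ e ∈ H.edgeSet, ∃ c, {v | v ∈ e ∧ c ∈ φ v}.ncard = 1

/-- The role of a node of the incidence network of a hypergraph. -/
inductive Role
  | vertex
  | hyperedge

/-- `(G, x)` is the bipartite incidence network of the hypergraph `H`: it has one node for each vertex
and one for each hyperedge, the node of a hyperedge `e` being adjacent to exactly the vertices in
`e`. -/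
def IsIncidenceNetwork {W : Type} (H : Hypergraph W) (G : SimpleGraph W) (x : W → Role) : Prop :=
  H.vertexSet = {w | x w = Role.vertex} ∧
    Set.BijOn G.neighborSet {w | x w = Role.hyperedge} H.edgeSet ∧
    ∀ u w, G.Adj u w → x u ≠ x w

/-- Conflict-free multicolouring with `q n` colours of `n`-vertex hypergraphs with at most `n ^ d`
hyperedges whose sizes lie between `k` and `(1 + ε) k` for some `k`. The network is the incidence
network of the hypergraph; the outputs of the hyperedge nodes are ignored. -/
def conflictFreeProblem (ε : ℝ) (d : ℕ) (q : ℕ → ℕ) : GraphProblem Role (Finset ℕ) where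
  dom {W} _ G x := ∃ H : Hypergraph W, IsIncidenceNetwork H G x ∧ AlmostUniform ε H ∧
    H.edgeSet.ncard ≤ H.vertexSet.ncard ^ d
  sol {W} _ G x y := ∀ H : Hypergraph W, IsIncidenceNetwork H G x →
    ConflictFreeMulticolouring H (q H.vertexSet.ncard) y

end Distrib

/-! Hardness and membership are separate matters. Hardness needs no reduction from one problem to
another: P-SLOCAL is contained in P-LOCAL (`PSLocal.pLocal`), so every problem of P-SLOCAL is
polylog-reducible to any problem at all.

The containment rests on deterministic network decomposition by bits of identifiers. Clusters start
as single nodes labelled by their `b`-bit identifiers. In phase `i`, nodes whose label has bit `i`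
equal to `0` ask to join a cluster within distance `r` whose label has bit `i` equal to `1`. A
cluster accepts if it grows by a factor of at least `1 + 1/(2b)`; otherwise the proposers are
deleted and the cluster is finished for the phase. Growth cannot last longer than `2b²` steps, and
at most a `1/(2b)` fraction of the nodes is lost per phase, so half survive all `b` phases. Then
close survivors agree on every bit: different clusters are more than `r` apart, while each cluster
has polylogarithmic weak radius (`clustering_spec`). An SLOCAL algorithm of locality `r` can
therefore treat all clusters in parallel as if they were processed in sequence. Repeating this on
the unprocessed nodes halves their number each time, and after `b` repetitions the result is a
genuine sequential execution for some order (`simulatedState_spec`).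

Membership in P-SLOCAL is a derandomised union bound. Let all hyperedge sizes lie in `[k, Jk]`, with
an integer `J ≥ 1 + ε`. If each vertex takes each of `m` colours independently with a probability
between `1/(2Jk)` and `1/(2k)`, a given colour is unique in a given hyperedge with probability at
least a constant `δ` (`le_uniqueProb`). The least degree of an incident hyperedge supplies such a
probability without knowledge of `k`. With `m` a large multiple of the logarithm, the expected
number of failing hyperedges is below `1`. The method of conditional expectations keeps it there,
because a vertex affects only its own hyperedges and so can choose with constant locality
(`exists_commit_le`, `expectedFailures_update`). At the end no hyperedge fails. -/

namespace Distrib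

/-! ### Balls and local functions on graphs whose nodes are identifiers -/

/-- The ball of radius `t` around `v`. -/
def ball {α : Type*} (adj : α → α → Prop) : ℕ → α → Set α
  | 0, v => {v}
  | t + 1, v => {u | ∃ w ∈ ball adj t v, u = w ∨ adj w u}

section Ball
variable {α : Type*} {adj adj' : α → α → Prop} {s t : ℕ} {u v w : α}

lemma mem_ball_zero : u ∈ ball adj 0 v ↔ u = v := Iff.rfl

lemma mem_ball_succ : u ∈ ball adj (t + 1) v ↔ ∃ w ∈ ball adj t v, u = w ∨ adj w u := Iff.rfl

lemma ball_subset_succ : ball adj t v ⊆ ball adj (t + 1) v := fun u hu => ⟨u, hu, Or.inl rfl⟩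

lemma ball_mono (h : s ≤ t) : ball adj s v ⊆ ball adj t v := by
  induction h with
  | refl => exact subset_rfl
  | step _ ih => exact ih.trans ball_subset_succ

lemma mem_ball_self : v ∈ ball adj t v := ball_mono (Nat.zero_le t) (mem_ball_zero.2 rfl)

lemma mem_ball_succ_of_adj (hu : u ∈ ball adj t v) (h : adj u w) : w ∈ ball adj (t + 1) v :=
  ⟨u, hu, Or.inr h⟩

lemma mem_ball_one_of_adj (h : adj v u) : u ∈ ball adj 1 v :=
  mem_ball_succ_of_adj mem_ball_self h

lemma mem_ball_add (hu : u ∈ ball adj s v) (hw : w ∈ ball adj t u) : w ∈ ball adj (s + t) v := by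
  induction t generalizing w with
  | zero => rw [mem_ball_zero] at hw; subst hw; exact hu
  | succ t ih =>
    obtain ⟨x, hx, h⟩ := hw
    exact ⟨x, ih hx, h⟩

lemma mem_ball_symm (hs : ∀ ⦃u v⦄, adj u v → adj v u) (h : u ∈ ball adj t v) : v ∈ ball adj t u := by
  induction t generalizing u with
  | zero => exact h.symm
  | succ t ih =>
    obtain ⟨w, hw, rfl | h⟩ := h
    · exact ball_subset_succ (ih hw)
    · rw [Nat.add_comm]
      exact mem_ball_add (mem_ball_one_of_adj (hs h)) (ih hw)

/-- Radius `t + 1` is within reach because the last step only uses the neighbours of nodes at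
distance at most `t`. -/
lemma ball_congr (h : ∀ u ∈ ball adj t v, ∀ w, adj u w ↔ adj' u w) (hs : s ≤ t + 1) :
    ball adj s v = ball adj' s v := by
  induction s with
  | zero => rfl
  | succ s ih =>
    have ih := ih (by omega)
    ext u
    rw [mem_ball_succ, mem_ball_succ, ← ih]
    refine exists_congr fun w => and_congr_right fun hw => ?_
    rw [h w (ball_mono (by omega) hw)]

end Ball

lemma edist_le_iff_mem_ball {V : Type*} (G : SimpleGraph V) (v u : V) (t : ℕ) :
    G.edist v u ≤ t ↔ u ∈ ball G.Adj t v := by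
  constructor
  · intro h
    obtain ⟨p, hp⟩ := G.exists_walk_of_edist_ne_top (ne_top_of_le_ne_top (ENat.natCast_ne_top t) h)
    rw [← hp, Nat.cast_le] at h
    refine ball_mono h ?_
    clear h hp
    induction p with
    | nil => exact mem_ball_self
    | cons hadj p ih =>
      rw [SimpleGraph.Walk.length_cons, Nat.add_comm]
      exact mem_ball_add (mem_ball_one_of_adj hadj) ih
  · intro h
    induction t generalizing u with
    | zero => rw [mem_ball_zero.1 h]; simp
    | succ t ih =>
      obtain ⟨w, hw, rfl | h⟩ := h
      · exact (ih _ hw).trans (by exact_mod_cast Nat.le_succ t)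
      · refine (SimpleGraph.edist_triangle (v := w)).trans ?_
        push_cast
        exact add_le_add (ih _ hw) (SimpleGraph.edist_eq_one_iff_adj.2 h).le

/-- The labelled graphs `(adj, x)` and `(adj', x')` have the same labels and the same neighbours at
all nodes of the ball of radius `t` around `v`. -/
def Agree {α : Type*} (adj adj' : ℕ → ℕ → Prop) (x x' : ℕ → α) (t v : ℕ) : Prop :=
  ∀ u ∈ ball adj t v, x u = x' u ∧ ∀ w, adj u w ↔ adj' u w

/-- `F` computes at each node a value that depends only on its neighbourhood of radius `t`. -/
def IsLocal {α β : Type*} (t : ℕ) (F : (ℕ → ℕ → Prop) → (ℕ → α) → ℕ → β) : Prop :=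
  ∀ ⦃adj adj' : ℕ → ℕ → Prop⦄ ⦃x x' : ℕ → α⦄ ⦃v : ℕ⦄, Agree adj adj' x x' t v →
    F adj x v = F adj' x' v

section Local
variable {α β γ : Type*} {adj adj' : ℕ → ℕ → Prop} {x x' : ℕ → α} {s t u v : ℕ}

lemma Agree.mono (h : Agree adj adj' x x' t v) (hs : s ≤ t) : Agree adj adj' x x' s v :=
  fun u hu => h u (ball_mono hs hu)

lemma Agree.of_mem (h : Agree adj adj' x x' (s + t) v) (hu : u ∈ ball adj s v) :
    Agree adj adj' x x' t u :=
  fun _ hw => h _ (mem_ball_add hu hw)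

lemma Agree.ball_eq (h : Agree adj adj' x x' t v) (hs : s ≤ t + 1) :
    ball adj s v = ball adj' s v :=
  ball_congr (fun u hu => (h u hu).2) hs

lemma Agree.label (h : Agree adj adj' x x' t v) : x v = x' v := (h v mem_ball_self).1

lemma Agree.adj_iff (h : Agree adj adj' x x' t v) (w : ℕ) : adj v w ↔ adj' v w :=
  (h v mem_ball_self).2 w

lemma IsLocal.mono {F : (ℕ → ℕ → Prop) → (ℕ → α) → ℕ → β} (hF : IsLocal s F) (h : s ≤ t) :
    IsLocal t F :=
  fun _ _ _ _ _ ha => hF (ha.mono h)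

lemma Agree.map {F : (ℕ → ℕ → Prop) → (ℕ → α) → ℕ → β} (hF : IsLocal t F)
    (h : Agree adj adj' x x' (s + t) v) : Agree adj adj' (F adj x) (F adj' x') s v :=
  fun u hu => ⟨hF (h.of_mem hu), (h u (ball_mono (Nat.le_add_right s t) hu)).2⟩

lemma IsLocal.comp {F : (ℕ → ℕ → Prop) → (ℕ → α) → ℕ → β}
    {F' : (ℕ → ℕ → Prop) → (ℕ → β) → ℕ → γ} (hF' : IsLocal s F') (hF : IsLocal t F) :
    IsLocal (s + t) fun adj x => F' adj (F adj x) :=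
  fun _ _ _ _ _ h => hF' (h.map hF)

lemma IsLocal.label (f : α → β) : IsLocal 0 fun _ (x : ℕ → α) v => f (x v) :=
  fun _ _ _ _ _ h => congrArg f h.label

end Local

/-! ### Networks as labelled graphs on their identifiers -/

section NetworkIds
variable {V I β : Type}

/-- Adjacency of identifiers. -/
def Network.idAdj (N : Network V I) (i j : ℕ) : Prop :=
  ∃ u w, N.graph.Adj u w ∧ i = N.ident u ∧ j = N.ident w

open Classical in
/-- A labelling of the nodes as a labelling of the identifiers, with `none` at unused identifiers. -/
noncomputable def Network.idLabel (N : Network V I) (x : V → β) (i : ℕ) : Option β :=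
  if h : ∃ u, N.ident u = i then some (x h.choose) else none

variable {N : Network V I}

lemma Network.idAdj_symm : ∀ ⦃i j⦄, N.idAdj i j → N.idAdj j i := by
  rintro _ _ ⟨u, w, h, rfl, rfl⟩
  exact ⟨w, u, h.symm, rfl, rfl⟩

lemma Network.idAdj_ident (hN : Function.Injective N.ident) {u w : V} :
    N.idAdj (N.ident u) (N.ident w) ↔ N.graph.Adj u w := by
  constructor
  · rintro ⟨u', w', h, hu, hw⟩
    rwa [hN hu, hN hw]
  · exact fun h => ⟨u, w, h, rfl, rfl⟩

lemma Network.idLabel_ident (hN : Function.Injective N.ident) (x : V → β) (v : V) :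
    N.idLabel x (N.ident v) = some (x v) := by
  have h : ∃ u, N.ident u = N.ident v := ⟨v, rfl⟩
  rw [Network.idLabel, dif_pos h, hN h.choose_spec]

lemma Network.idLabel_eq_some (hN : Function.Injective N.ident) {x : V → β} {i : ℕ} {b : β} :
    N.idLabel x i = some b ↔ ∃ v, N.ident v = i ∧ x v = b := by
  constructor
  · intro h
    by_cases hi : ∃ u, N.ident u = i
    · obtain ⟨u, rfl⟩ := hi
      rw [idLabel_ident hN] at h
      exact ⟨u, rfl, Option.some.inj h⟩
    · rw [Network.idLabel, dif_neg hi] at h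
      cases h
  · rintro ⟨v, rfl, rfl⟩
    exact idLabel_ident hN x v

lemma Network.mem_ball_idAdj (hN : Function.Injective N.ident) {t i : ℕ} {v : V} :
    i ∈ ball N.idAdj t (N.ident v) ↔ ∃ u ∈ ball N.graph.Adj t v, i = N.ident u := by
  induction t generalizing i with
  | zero => simp [mem_ball_zero]
  | succ t ih =>
    constructor
    · rintro ⟨w, hw, h⟩
      obtain ⟨u, hu, rfl⟩ := ih.1 hw
      rcases h with rfl | ⟨u', w', h, h1, rfl⟩
      · exact ⟨u, ball_subset_succ hu, rfl⟩
      · rw [hN h1] at hu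
        exact ⟨w', mem_ball_succ_of_adj hu h, rfl⟩
    · rintro ⟨u, ⟨w, hw, h⟩, rfl⟩
      refine ⟨N.ident w, ih.2 ⟨w, hw, rfl⟩, ?_⟩
      rcases h with rfl | h
      · exact Or.inl rfl
      · exact Or.inr ⟨w, u, h, rfl, rfl⟩

open Classical in
/-- The labelling described by a set of pairs of an identifier and its label. -/
noncomputable def labelOfSet (nodes : Set (ℕ × β)) (i : ℕ) : Option β :=
  if h : ∃ b, (i, b) ∈ nodes then some h.choose else none

/-- Facts that are true everywhere and complete in the ball determine the labelled graph there:
unique identifiers leave `labelOfSet` no choice. This serves both gathered knowledge and SLOCAL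
views. -/
lemma Network.agree_of_facts (hN : Function.Injective N.ident) (x : V → β)
    {nodes : Set (ℕ × β)} {edges : Set (ℕ × ℕ)} {t : ℕ} {v : V}
    (hn : ∀ p ∈ nodes, ∃ u, p = (N.ident u, x u))
    (hn' : ∀ u ∈ ball N.graph.Adj t v, (N.ident u, x u) ∈ nodes)
    (he : ∀ p ∈ edges, ∃ u w, N.graph.Adj u w ∧ p = (N.ident u, N.ident w))
    (he' : ∀ u ∈ ball N.graph.Adj t v, ∀ w, N.graph.Adj u w → (N.ident u, N.ident w) ∈ edges) :
    Agree N.idAdj (fun i j => (i, j) ∈ edges) (N.idLabel x) (labelOfSet nodes) t (N.ident v) := by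
  intro i hi
  obtain ⟨u, hu, rfl⟩ := (mem_ball_idAdj hN).1 hi
  constructor
  · have h : ∃ b, (N.ident u, b) ∈ nodes := ⟨_, hn' u hu⟩
    rw [idLabel_ident hN, labelOfSet, dif_pos h]
    obtain ⟨w, hw⟩ := hn _ h.choose_spec
    obtain ⟨h1, h2⟩ := Prod.mk.inj hw
    rw [h2, hN h1]
  · intro j
    constructor
    · rintro ⟨u', w, h, h1, rfl⟩
      rw [← hN h1] at h
      exact he' u hu w h
    · intro h
      obtain ⟨u', w, h, h1⟩ := he _ h
      obtain ⟨h1, h2⟩ := Prod.mk.inj h1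
      exact ⟨u', w, h, h1, h2⟩

end NetworkIds

/-! ### Gathering neighbourhoods in the LOCAL model -/

/-- What a node knows during the gathering algorithm. -/
structure Knowledge (I : Type) where
  size : ℕ
  center : ℕ
  nodes : Set (ℕ × I)
  edges : Set (ℕ × ℕ)

/-- Each node collects the nodes and edges of its neighbourhood of radius `t n + 1`, and then applies
`F`. -/
noncomputable def gatherAlg {I O : Type} (t : ℕ → ℕ)
    (F : ℕ → (ℕ → ℕ → Prop) → (ℕ → Option I) → ℕ → O) : LocalAlg I O where
  State := Knowledge I
  Msg := Knowledge I
  rounds n := t n + 1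
  init n i x := ⟨n, i, {(i, x)}, ∅⟩
  send s _ := s
  step s m := ⟨s.size, s.center, s.nodes ∪ {p | ∃ q ∈ m, p ∈ q.2.nodes},
    s.edges ∪ {p | ∃ q ∈ m, p ∈ q.2.edges ∨ p = (s.center, q.1)}⟩
  out s := F s.size (fun i j => (i, j) ∈ s.edges) (labelOfSet s.nodes) s.center

section Gather
variable {V I O : Type} [Fintype V] (t : ℕ → ℕ)
  (F : ℕ → (ℕ → ℕ → Prop) → (ℕ → Option I) → ℕ → O) (N : Network V I)

lemma gatherAlg_size_center (k : ℕ) (v : V) :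
    ((gatherAlg t F).stateAfter N k v).size = Fintype.card V ∧
      ((gatherAlg t F).stateAfter N k v).center = N.ident v := by
  induction k with
  | zero => exact ⟨rfl, rfl⟩
  | succ k ih => exact ih

lemma gatherAlg_sound (k : ℕ) (v : V) :
    (∀ p ∈ ((gatherAlg t F).stateAfter N k v).nodes, ∃ u, p = (N.ident u, N.input u)) ∧
      ∀ p ∈ ((gatherAlg t F).stateAfter N k v).edges,
        ∃ u w, N.graph.Adj u w ∧ p = (N.ident u, N.ident w) := by
  induction k generalizing v with
  | zero => exact ⟨fun p hp => ⟨v, hp⟩, fun p hp => hp.elim⟩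
  | succ k ih =>
    constructor
    · rintro p (hp | ⟨q, ⟨u, _, rfl⟩, hp⟩)
      · exact (ih v).1 p hp
      · exact (ih u).1 p hp
    · rintro p (hp | ⟨q, ⟨u, hu, rfl⟩, hp | rfl⟩)
      · exact (ih v).2 p hp
      · exact (ih u).2 p hp
      · refine ⟨v, u, hu, ?_⟩
        rw [(gatherAlg_size_center t F N k v).2]

lemma gatherAlg_nodes_complete (k : ℕ) (v u : V) (hu : u ∈ ball N.graph.Adj k v) :
    (N.ident u, N.input u) ∈ ((gatherAlg t F).stateAfter N k v).nodes := by
  induction k generalizing v with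
  | zero => rw [mem_ball_zero] at hu; subst hu; rfl
  | succ k ih =>
    -- Balls grow at their far end, but messages arrive over the first edge of a path; symmetry of
    -- the distance splits off that first edge.
    obtain ⟨w, hw, h⟩ := mem_ball_symm (fun _ _ => N.graph.adj_symm) hu
    replace hw := mem_ball_symm (fun _ _ => N.graph.adj_symm) hw
    rcases h with rfl | h
    · exact Or.inl (ih _ hw)
    · exact Or.inr ⟨_, ⟨w, h.symm, rfl⟩, ih w hw⟩

lemma gatherAlg_edges_complete (k : ℕ) (v u w : V) (hu : u ∈ ball N.graph.Adj k v)
    (huw : N.graph.Adj u w) :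
    (N.ident u, N.ident w) ∈ ((gatherAlg t F).stateAfter N (k + 1) v).edges := by
  induction k generalizing v with
  | zero =>
    rw [mem_ball_zero] at hu; subst hu
    exact Or.inr ⟨_, ⟨w, huw, rfl⟩, Or.inr (by rw [(gatherAlg_size_center t F N 0 u).2])⟩
  | succ k ih =>
    obtain ⟨z, hz, h⟩ := mem_ball_symm (fun _ _ => N.graph.adj_symm) hu
    replace hz := mem_ball_symm (fun _ _ => N.graph.adj_symm) hz
    rcases h with rfl | h
    · exact Or.inl (ih _ hz)
    · exact Or.inr ⟨_, ⟨z, h.symm, rfl⟩, Or.inl (ih z hz)⟩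

/-- The round beyond `t` brings in the edges that leave nodes at distance exactly `t`. -/
lemma gatherAlg_output (hN : Function.Injective N.ident)
    (hF : IsLocal (t (Fintype.card V)) (F (Fintype.card V))) (v : V) :
    (gatherAlg t F).output N v =
      F (Fintype.card V) N.idAdj (N.idLabel N.input) (N.ident v) := by
  set s := (gatherAlg t F).stateAfter N (t (Fintype.card V) + 1) v with hs
  have h : (gatherAlg t F).output N v =
    F s.size (fun i j => (i, j) ∈ s.edges) (labelOfSet s.nodes) s.center := rfl
  rw [h, (gatherAlg_size_center t F N _ v).1, (gatherAlg_size_center t F N _ v).2]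
  refine (hF (Network.agree_of_facts hN N.input ?_ ?_ ?_ ?_)).symm
  · exact (gatherAlg_sound t F N _ v).1
  · exact fun u hu => gatherAlg_nodes_complete t F N _ v u (ball_subset_succ hu)
  · exact (gatherAlg_sound t F N _ v).2
  · exact fun u hu w h => gatherAlg_edges_complete t F N _ v u w hu h

end Gather

/-! ### The SLOCAL model on labelled graphs on identifiers -/

/-- The function computed by a node from its view in an SLOCAL algorithm, when this function is given
by a local function `F` of the labelled graph. -/
noncomputable def View.apply {I S : Type}
    (F : (ℕ → ℕ → Prop) → (ℕ → Option (I × Option S)) → ℕ → S) (w : View I S) : S :=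
  F (fun i j => (i, j) ∈ w.edges) (labelOfSet w.nodes) w.center

/-- A view shows only edges with both ends inside it, so one hop more than the locality of `F` is
needed. -/
lemma Network.view_apply {V I S : Type} {N : Network V I} (hN : Function.Injective N.ident) {t : ℕ}
    {F : (ℕ → ℕ → Prop) → (ℕ → Option (I × Option S)) → ℕ → S} (hF : IsLocal t F)
    (s : V → Option S) (v : V) :
    (N.view (t + 1) s v).apply F =
      F N.idAdj (N.idLabel fun u => (N.input u, s u)) (N.ident v) := by
  refine (hF (Network.agree_of_facts hN (fun u => (N.input u, s u)) ?_ ?_ ?_ ?_)).symm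
  · rintro p ⟨u, _, rfl⟩
    exact ⟨u, rfl⟩
  · exact fun u hu => ⟨u, (edist_le_iff_mem_ball _ _ _ _).2 (ball_subset_succ hu), rfl⟩
  · rintro p ⟨u, w, _, _, h, rfl⟩
    exact ⟨u, w, h, rfl⟩
  · exact fun u hu w h => ⟨u, w, (edist_le_iff_mem_ball _ _ _ _).2 (ball_subset_succ hu),
      (edist_le_iff_mem_ball _ _ _ _).2 (mem_ball_succ_of_adj hu h), h, rfl⟩

/-- The view of `v` in a labelled graph on identifiers. -/
def idView {I S : Type} (adj : ℕ → ℕ → Prop) (x : ℕ → Option I) (r : ℕ) (s : ℕ → Option S)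
    (v : ℕ) : View I S where
  center := v
  nodes := {p | ∃ u ∈ ball adj r v, ∃ i, x u = some i ∧ p = (u, i, s u)}
  edges := {p | ∃ u ∈ ball adj r v, ∃ w ∈ ball adj r v, adj u w ∧ p = (u, w)}

/-- The states after the nodes in the list have been processed one by one. -/
def idRun {I S : Type} (f : View I S → S) (adj : ℕ → ℕ → Prop) (x : ℕ → Option I) (r : ℕ) :
    (ℕ → Option S) → List ℕ → ℕ → Option S
  | s, [] => s
  | s, v :: l => idRun f adj x r (Function.update s v (some (f (idView adj x r s v)))) l

section Run
variable {V I O S : Type}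

lemma Network.view_eq_idView {N : Network V I} (hN : Function.Injective N.ident) (r : ℕ)
    {s : V → Option S} {s' : ℕ → Option S} (hs : ∀ v, s' (N.ident v) = s v) (v : V) :
    N.view r s v = idView N.idAdj (N.idLabel N.input) r s' (N.ident v) := by
  unfold Network.view idView
  congr 1
  · ext p
    constructor
    · rintro ⟨u, hu, rfl⟩
      exact ⟨_, (mem_ball_idAdj hN).2 ⟨u, (edist_le_iff_mem_ball _ _ _ _).1 hu, rfl⟩, _,
        idLabel_ident hN _ u, by rw [hs]⟩
    · rintro ⟨_, hu, i, hi, rfl⟩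
      obtain ⟨u, hu', rfl⟩ := (mem_ball_idAdj hN).1 hu
      rw [idLabel_ident hN] at hi
      exact ⟨u, (edist_le_iff_mem_ball _ _ _ _).2 hu', by rw [hs, Option.some.inj hi]⟩
  · ext p
    constructor
    · rintro ⟨u, w, hu, hw, h, rfl⟩
      exact ⟨_, (mem_ball_idAdj hN).2 ⟨u, (edist_le_iff_mem_ball _ _ _ _).1 hu, rfl⟩, _,
        (mem_ball_idAdj hN).2 ⟨w, (edist_le_iff_mem_ball _ _ _ _).1 hw, rfl⟩,
        (idAdj_ident hN).2 h, rfl⟩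
    · rintro ⟨_, hu, _, hw, h, rfl⟩
      obtain ⟨u, hu', rfl⟩ := (mem_ball_idAdj hN).1 hu
      obtain ⟨w, hw', rfl⟩ := (mem_ball_idAdj hN).1 hw
      exact ⟨u, w, (edist_le_iff_mem_ball _ _ _ _).2 hu', (edist_le_iff_mem_ball _ _ _ _).2 hw',
        (idAdj_ident hN).1 h, rfl⟩

/-- An execution can be expressed through identifiers alone, which is what makes it computable from
gathered knowledge. -/
lemma SLocalAlg.runFrom_eq_idRun [Fintype V] (A : SLocalAlg I O) {N : Network V I}
    (hN : Function.Injective N.ident) (l : List V) {s : V → Option A.State}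
    {s' : ℕ → Option A.State} (hs : ∀ v, s' (N.ident v) = s v) (v : V) :
    A.runFrom N s l v = idRun (A.process (Fintype.card V)) N.idAdj (N.idLabel N.input)
      (A.locality (Fintype.card V)) s' (l.map N.ident) (N.ident v) := by
  induction l generalizing s s' with
  | nil => exact (hs v).symm
  | cons w l ih =>
    classical
    refine ih fun u => ?_
    rw [← Network.view_eq_idView hN _ hs]
    by_cases h : u = w
    · subst h; simp
    · rw [Function.update_of_ne h, Function.update_of_ne (hN.ne h), hs]

variable {adj adj' : ℕ → ℕ → Prop} {x x' : ℕ → Option I} {r : ℕ}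

lemma idRun_append (f : View I S → S) (s : ℕ → Option S) (l l' : List ℕ) :
    idRun f adj x r s (l ++ l') = idRun f adj x r (idRun f adj x r s l) l' := by
  induction l generalizing s with
  | nil => rfl
  | cons v l ih => exact ih _

lemma idRun_of_notMem (f : View I S → S) {s : ℕ → Option S} {l : List ℕ} {v : ℕ} (h : v ∉ l) :
    idRun f adj x r s l v = s v := by
  induction l generalizing s with
  | nil => rfl
  | cons w l ih =>
    rw [List.mem_cons, not_or] at h
    rw [idRun, ih h.2, Function.update_of_ne h.1]

lemma idRun_ne_none_of_mem (f : View I S → S) {s : ℕ → Option S} {l : List ℕ} {v : ℕ}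
    (h : s v ≠ none ∨ v ∈ l) : idRun f adj x r s l v ≠ none := by
  induction l generalizing s with
  | nil => simpa [idRun] using h
  | cons w l ih =>
    refine ih ?_
    by_cases hv : v = w
    · subst hv; simp
    · rw [Function.update_of_ne hv]
      simpa [hv] using h

lemma idView_congr {s s' : ℕ → Option S} {v : ℕ}
    (h : Agree adj adj' (fun u => (x u, s u)) (fun u => (x' u, s' u)) r v) :
    idView adj x r s v = idView adj' x' r s' v := by
  have hl : ∀ u ∈ ball adj r v, x u = x' u ∧ s u = s' u := fun u hu => Prod.mk.inj (h u hu).1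
  unfold idView
  rw [← h.ball_eq (Nat.le_succ r)]
  congr 1
  · ext p
    refine exists_congr fun u => and_congr_right fun hu => ?_
    rw [(hl u hu).1, (hl u hu).2]
  · ext p
    refine exists_congr fun u => and_congr_right fun hu => exists_congr fun w => ?_
    rw [(h u hu).2 w]

/-- Every processed node is within `D` of `v` and looks only `r` further. -/
lemma idRun_congr (f : View I S → S) {D v : ℕ} {s s' : ℕ → Option S} {l : List ℕ}
    (hl : ∀ u ∈ l, u ∈ ball adj D v)
    (h : Agree adj adj' (fun u => (x u, s u)) (fun u => (x' u, s' u)) (D + r) v) :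
    idRun f adj x r s l v = idRun f adj' x' r s' l v := by
  induction l generalizing s s' with
  | nil => exact (Prod.mk.inj h.label).2
  | cons w l ih =>
    rw [idRun, idRun, idView_congr (h.of_mem (hl w (by simp)))]
    refine ih (fun u hu => hl u (List.mem_cons_of_mem _ hu)) fun u hu => ⟨?_, (h u hu).2⟩
    obtain ⟨h1, h2⟩ := Prod.mk.inj (h u hu).1
    refine Prod.ext h1 ?_
    by_cases huw : u = w
    · subst huw; simp
    · simpa [Function.update_of_ne huw] using h2

/-- Nodes at distance more than `r` from `p` do not influence the nodes in `p`. -/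
lemma idRun_filter (f : View I S → S) (p : ℕ → Bool) {s : ℕ → Option S} {l : List ℕ}
    (hfar : ∀ v ∈ l, ∀ w ∈ l, p v = true → w ∈ ball adj r v → p w = true) {v : ℕ}
    (hv : p v = true) (hvl : v ∈ l) :
    idRun f adj x r s l v = idRun f adj x r s (l.filter p) v := by
  -- The invariant for the induction: both executions agree on everything that a node of `l` in `p`
  -- can see.
  suffices h : ∀ l' : List ℕ, l' ⊆ l → ∀ s s' : ℕ → Option S,
      (∀ u ∈ l, p u = true → ∀ w ∈ ball adj r u, s w = s' w) →
      ∀ u ∈ l, p u = true → ∀ w ∈ ball adj r u,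
        idRun f adj x r s l' w = idRun f adj x r s' (l'.filter p) w from
    h l (List.Subset.refl l) s s (fun _ _ _ _ _ => rfl) v hvl hv v mem_ball_self
  intro l'
  induction l' with
  | nil => exact fun _ s s' h => h
  | cons a l' ih =>
    intro hsub s s' h
    have ha : a ∈ l := hsub (by simp)
    have hsub' : l' ⊆ l := fun b hb => hsub (List.mem_cons_of_mem _ hb)
    by_cases hp : p a = true
    · rw [List.filter_cons_of_pos hp]
      refine ih hsub' _ _ fun u hu hpu w hw => ?_
      have hview : idView adj x r s a = idView adj x r s' a :=
        idView_congr fun w hw => ⟨Prod.ext rfl (h a ha hp w hw), fun _ => Iff.rfl⟩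
      rw [hview]
      by_cases hwa : w = a
      · subst hwa; simp
      · simpa [Function.update_of_ne hwa] using h u hu hpu w hw
    · rw [List.filter_cons_of_neg hp]
      refine ih hsub' _ _ fun u hu hpu w hw => ?_
      -- A node of `l` outside `p` is invisible to the nodes of `l` in `p`, so processing it
      -- preserves the invariant.
      have hwa : w ≠ a := by
        rintro rfl
        exact hp (hfar u hu w ha hpu hw)
      rw [Function.update_of_ne hwa]
      exact h u hu hpu w hw

end Run

/-! ### Deterministic clustering -/

lemma IsLocal.iterate {α : Type*} {t : ℕ} {F : (ℕ → ℕ → Prop) → (ℕ → α) → ℕ → α}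
    (hF : IsLocal t F) (k : ℕ) : IsLocal (k * t) fun adj x => (F adj)^[k] x := by
  induction k with
  | zero => exact (IsLocal.label id).mono (Nat.zero_le _)
  | succ k ih =>
    simp only [Function.iterate_succ_apply']
    exact (hF.comp ih).mono (by rw [Nat.succ_mul, Nat.add_comm])

open Classical in
/-- Some number with property `P`, if there is one. -/
noncomputable def pick (P : ℕ → Prop) : Option ℕ := if h : ∃ L, P L then some h.choose else none

lemma pick_eq_some {P : ℕ → Prop} {L : ℕ} (h : pick P = some L) : P L := by
  unfold pick at h
  split_ifs at h with hP
  rw [← Option.some.inj h]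
  exact hP.choose_spec

lemma pick_eq_none {P : ℕ → Prop} (h : pick P = none) (L : ℕ) : ¬ P L := by
  unfold pick at h
  split_ifs at h with hP
  exact fun hL => hP ⟨L, hL⟩

/-- The nodes `v` whose label has bit `i` equal to `0` propose to join a cluster (class of nodes with
the same label) at distance at most `r` whose label has bit `i` equal to `1`, if there is one. -/
noncomputable def proposal (r i : ℕ) (adj : ℕ → ℕ → Prop) (ℓ : ℕ → Option ℕ) (v : ℕ) : Option ℕ :=
  pick fun L => (∃ L₀, ℓ v = some L₀ ∧ L₀.testBit i = false) ∧ L.testBit i = true ∧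
    ∃ u ∈ ball adj r v, ℓ u = some L

open Classical in
/-- One step of the clustering algorithm: a cluster accepts the proposals to it if these are many
compared to its size; otherwise the nodes that made them drop out. The numbers are evaluated in the
ball of radius `T`. -/
noncomputable def clusterStep (r b M T i : ℕ) (adj : ℕ → ℕ → Prop) (ℓ : ℕ → Option ℕ) (v : ℕ) :
    Option ℕ :=
  match proposal r i adj ℓ v with
  | none => ℓ v
  | some L =>
    if ((Finset.range M).filter fun u => u ∈ ball adj T v ∧ ℓ u = some L).card ≤
        2 * b * ((Finset.range M).filter fun u =>
          u ∈ ball adj T v ∧ proposal r i adj ℓ u = some L).card then some L else none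

/-- The nodes with label `L`. -/
def cluster (M : ℕ) (ℓ : ℕ → Option ℕ) (L : ℕ) : Finset ℕ :=
  (Finset.range M).filter fun u => ℓ u = some L

/-- The nodes that propose to join the cluster with label `L`. -/
noncomputable def proposers (r M i : ℕ) (adj : ℕ → ℕ → Prop) (ℓ : ℕ → Option ℕ) (L : ℕ) : Finset ℕ :=
  (Finset.range M).filter fun u => proposal r i adj ℓ u = some L

/-- `clusterStep` with an unrestricted evaluation of the numbers of nodes. -/
noncomputable def globalStep (r b M i : ℕ) (adj : ℕ → ℕ → Prop) (ℓ : ℕ → Option ℕ) (v : ℕ) :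
    Option ℕ :=
  match proposal r i adj ℓ v with
  | none => ℓ v
  | some L =>
    if (cluster M ℓ L).card ≤ 2 * b * (proposers r M i adj ℓ L).card then some L else none

/-- `pick` is a function of the predicate, so equal neighbourhoods lead to the same arbitrary
choice. -/
lemma isLocal_proposal (r i : ℕ) : IsLocal r (proposal r i) := by
  intro adj adj' x x' v h
  unfold proposal
  congr 1
  ext L
  rw [h.label, ← h.ball_eq (Nat.le_succ r)]
  refine and_congr_right fun _ => and_congr_right fun _ => exists_congr fun u =>
    and_congr_right fun hu => ?_
  rw [(h u hu).1]

lemma isLocal_clusterStep (r b M T i : ℕ) : IsLocal (T + r) (clusterStep r b M T i) := by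
  intro adj adj' x x' v h
  classical
  have h1 := isLocal_proposal r i (h.mono (Nat.le_add_left r T))
  have h2 : ∀ u ∈ ball adj T v, proposal r i adj x u = proposal r i adj' x' u :=
    fun u hu => isLocal_proposal r i (h.of_mem hu)
  unfold clusterStep
  rw [← h1, h.label]
  cases proposal r i adj x v with
  | none => rfl
  | some L =>
    dsimp only
    have e1 : ((Finset.range M).filter fun u => u ∈ ball adj T v ∧ x u = some L) =
        (Finset.range M).filter fun u => u ∈ ball adj' T v ∧ x' u = some L := by
      refine Finset.filter_congr fun u _ => ?_
      rw [← h.ball_eq (by omega)]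
      exact and_congr_right fun hu => by rw [(h u (ball_mono (by omega) hu)).1]
    have e2 : ((Finset.range M).filter fun u => u ∈ ball adj T v ∧ proposal r i adj x u = some L) =
        (Finset.range M).filter fun u => u ∈ ball adj' T v ∧ proposal r i adj' x' u = some L := by
      refine Finset.filter_congr fun u _ => ?_
      rw [← h.ball_eq (by omega)]
      exact and_congr_right fun hu => by rw [h2 u hu]
    rw [e1, e2]

/-! ### One step of the clustering: growth, stopping and losses -/

section Step
variable {r b M i R T : ℕ} {adj : ℕ → ℕ → Prop} {ℓ : ℕ → Option ℕ} {u v L L₀ : ℕ}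

lemma proposal_eq_some (h : proposal r i adj ℓ v = some L) :
    (∃ L₀, ℓ v = some L₀ ∧ L₀.testBit i = false) ∧ L.testBit i = true ∧
      ∃ u ∈ ball adj r v, ℓ u = some L :=
  pick_eq_some h

lemma proposal_of_testBit (h : ℓ v = some L) (hL : L.testBit i = true) :
    proposal r i adj ℓ v = none := by
  by_contra hp
  obtain ⟨L', hL'⟩ := Option.ne_none_iff_exists'.1 hp
  obtain ⟨⟨L₀, h0, h1⟩, _⟩ := proposal_eq_some hL'
  rw [h] at h0
  rw [← Option.some.inj h0, hL] at h1
  cases h1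

lemma globalStep_eq_some : globalStep r b M i adj ℓ v = some L ↔
    (proposal r i adj ℓ v = none ∧ ℓ v = some L) ∨ (proposal r i adj ℓ v = some L ∧
      (cluster M ℓ L).card ≤ 2 * b * (proposers r M i adj ℓ L).card) := by
  unfold globalStep
  cases h : proposal r i adj ℓ v with
  | none => simp
  | some L' =>
    dsimp only
    split_ifs with hc
    · constructor
      · intro h; cases h; exact Or.inr ⟨rfl, hc⟩
      · rintro (⟨h, _⟩ | ⟨h, _⟩)
        · cases h
        · exact h
    · constructor
      · intro h; cases h
      · rintro (⟨h, _⟩ | ⟨h, h'⟩)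
        · cases h
        · cases h; exact absurd h' hc

lemma globalStep_of_testBit (h : ℓ v = some L) (hL : L.testBit i = true) :
    globalStep r b M i adj ℓ v = some L :=
  globalStep_eq_some.2 (Or.inl ⟨proposal_of_testBit h hL, h⟩)

lemma eq_some_of_globalStep (h : globalStep r b M i adj ℓ v = some L) (hL : L.testBit i = false) :
    proposal r i adj ℓ v = none ∧ ℓ v = some L := by
  rcases globalStep_eq_some.1 h with h | ⟨h, _⟩
  · exact h
  · rw [(proposal_eq_some h).2.1] at hL
    cases hL

/-- No node with bit `i` equal to `0` is close to the cluster with label `L`. -/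
def Stopped (r i : ℕ) (adj : ℕ → ℕ → Prop) (ℓ : ℕ → Option ℕ) (L : ℕ) : Prop :=
  ∀ v L₀, ℓ v = some L₀ → ∀ u ∈ ball adj r v, ℓ u = some L → L₀.testBit i = true

lemma Stopped.proposal_ne (h : Stopped r i adj ℓ L) (v : ℕ) : proposal r i adj ℓ v ≠ some L := by
  intro hv
  obtain ⟨⟨L₀, h0, h1⟩, _, u, hu, hL⟩ := proposal_eq_some hv
  rw [h v L₀ h0 u hu hL] at h1
  cases h1

/-- Labels with bit `i` equal to `0` are never newly acquired, and a stopped cluster receives no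
proposals, so no new close pair can arise. -/
lemma Stopped.globalStep (h : Stopped r i adj ℓ L) :
    Stopped r i adj (globalStep r b M i adj ℓ) L := by
  intro v L₀ hv u hu hL
  by_contra hb
  obtain ⟨_, hv⟩ := eq_some_of_globalStep hv (by simpa using hb)
  rcases globalStep_eq_some.1 hL with ⟨_, hL⟩ | ⟨hL, _⟩
  · exact hb (h v L₀ hv u hu hL)
  · exact h.proposal_ne u hL

/-- After a refusal the cluster has gained nobody, and a node that still has bit `0` made no
proposal, hence had no cluster with bit `1` in reach. -/
lemma stopped_globalStep (hL : L.testBit i = true)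
    (hc : 2 * b * (proposers r M i adj ℓ L).card < (cluster M ℓ L).card) :
    Stopped r i adj (globalStep r b M i adj ℓ) L := by
  intro v L₀ hv u hu hLu
  by_contra hb
  rw [Bool.not_eq_true] at hb
  obtain ⟨hp, hv⟩ := eq_some_of_globalStep hv hb
  rcases globalStep_eq_some.1 hLu with ⟨_, hLu⟩ | ⟨_, hc'⟩
  · exact pick_eq_none hp L ⟨⟨L₀, hv, hb⟩, hL, u, hu, hLu⟩
  · omega

/-- Members with bit `1` never leave, and the accepted proposers are new: growth by a factor of at
least `1 + 1/(2b)`, with denominators cleared. -/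
lemma card_cluster_globalStep (hL : L.testBit i = true)
    (hc : (cluster M ℓ L).card ≤ 2 * b * (proposers r M i adj ℓ L).card) :
    (2 * b + 1) * (cluster M ℓ L).card ≤
      2 * b * (cluster M (globalStep r b M i adj ℓ) L).card := by
  have hd : Disjoint (cluster M ℓ L) (proposers r M i adj ℓ L) := by
    refine Finset.disjoint_left.2 fun u hu hu' => ?_
    rw [cluster, Finset.mem_filter] at hu
    rw [proposers, Finset.mem_filter, proposal_of_testBit hu.2 hL] at hu'
    cases hu'.2
  have hs : cluster M ℓ L ∪ proposers r M i adj ℓ L ⊆ cluster M (globalStep r b M i adj ℓ) L := by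
    refine Finset.union_subset (fun u hu => ?_) fun u hu => ?_
    · rw [cluster, Finset.mem_filter] at hu ⊢
      exact ⟨hu.1, globalStep_of_testBit hu.2 hL⟩
    · rw [proposers, Finset.mem_filter] at hu
      rw [cluster, Finset.mem_filter]
      exact ⟨hu.1, globalStep_eq_some.2 (Or.inr ⟨hu.2, hc⟩)⟩
  have h := Finset.card_le_card hs
  rw [Finset.card_union_of_disjoint hd] at h
  nlinarith [Nat.mul_le_mul_left (2 * b) h]

/-- The nodes that have a label. -/
def living (M : ℕ) (ℓ : ℕ → Option ℕ) : Finset ℕ := (Finset.range M).filter fun u => ℓ u ≠ none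

open Classical in
/-- The nodes of the clusters that do not grow any more. -/
noncomputable def stoppedNodes (r M i : ℕ) (adj : ℕ → ℕ → Prop) (ℓ : ℕ → Option ℕ) : Finset ℕ :=
  (Finset.range M).filter fun u => ∃ L, ℓ u = some L ∧ L.testBit i = true ∧ Stopped r i adj ℓ L

lemma mul_card_le_card_of_fibers {α β : Type*} [DecidableEq β] (A B : Finset α) (f g : α → β)
    (c : ℕ) (h : ∀ a ∈ A, c * (A.filter fun a' => f a' = f a).card ≤
      (B.filter fun a' => g a' = f a).card) :
    c * A.card ≤ B.card := by
  rw [Finset.card_eq_sum_card_image f A, Finset.mul_sum]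
  calc ∑ y ∈ A.image f, c * (A.filter fun a => f a = y).card
      ≤ ∑ y ∈ A.image f, (B.filter fun a => g a = y).card := by
        refine Finset.sum_le_sum fun y hy => ?_
        obtain ⟨a, ha, rfl⟩ := Finset.mem_image.1 hy
        exact h a ha
    _ = (B.filter fun a => g a ∈ A.image f).card := Finset.sum_card_fiberwise_eq_card_filter _ _ _
    _ ≤ B.card := Finset.card_filter_le _ _

/-- A potential argument: each deleted node costs `2b`, paid by the cluster that refused it. That
cluster has more than `2b` nodes per deleted node, and it pays once per phase, since it becomes
stopped and a stopped cluster gets no proposals. -/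
lemma card_living_globalStep :
    2 * b * (living M ℓ).card + (stoppedNodes r M i adj ℓ).card ≤
      2 * b * (living M (globalStep r b M i adj ℓ)).card +
        (stoppedNodes r M i adj (globalStep r b M i adj ℓ)).card := by
  classical
  set ℓ' := globalStep r b M i adj ℓ with hℓ'
  -- `A` consists of the nodes deleted in this step, `B` of the nodes of the clusters that refused
  -- some proposal.
  let A := (Finset.range M).filter fun v => ∃ L, proposal r i adj ℓ v = some L ∧
    2 * b * (proposers r M i adj ℓ L).card < (cluster M ℓ L).card
  let B := (Finset.range M).filter fun u => ∃ L, ℓ u = some L ∧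
    2 * b * (proposers r M i adj ℓ L).card < (cluster M ℓ L).card ∧
      (proposers r M i adj ℓ L).Nonempty
  have hAB : 2 * b * A.card ≤ B.card := by
    refine mul_card_le_card_of_fibers A B (proposal r i adj ℓ) ℓ _ fun v hv => ?_
    obtain ⟨hvM, L, hL, hc⟩ := Finset.mem_filter.1 hv
    have hvp : v ∈ proposers r M i adj ℓ L := Finset.mem_filter.2 ⟨hvM, hL⟩
    have h1 : (A.filter fun a => proposal r i adj ℓ a = proposal r i adj ℓ v) ⊆
        proposers r M i adj ℓ L := by
      intro u hu
      rw [Finset.mem_filter] at hu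
      exact Finset.mem_filter.2 ⟨(Finset.mem_filter.1 hu.1).1, hu.2.trans hL⟩
    have h2 : cluster M ℓ L ⊆ B.filter fun a => ℓ a = proposal r i adj ℓ v := by
      intro u hu
      rw [cluster, Finset.mem_filter] at hu
      exact Finset.mem_filter.2 ⟨Finset.mem_filter.2 ⟨hu.1, L, hu.2, hc, v, hvp⟩, hu.2.trans hL.symm⟩
    calc _ ≤ 2 * b * (proposers r M i adj ℓ L).card :=
          Nat.mul_le_mul_left _ (Finset.card_le_card h1)
      _ ≤ (cluster M ℓ L).card := hc.le
      _ ≤ _ := Finset.card_le_card h2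
  have hliv : living M ℓ ⊆ living M ℓ' ∪ A := by
    intro u hu
    obtain ⟨huM, hu⟩ := Finset.mem_filter.1 hu
    by_cases huA : u ∈ A
    · exact Finset.mem_union_right _ huA
    refine Finset.mem_union_left _ (Finset.mem_filter.2 ⟨huM, ?_⟩)
    cases hp : proposal r i adj ℓ u with
    | none =>
      obtain ⟨L, hL⟩ := Option.ne_none_iff_exists'.1 hu
      rw [hℓ', globalStep_eq_some.2 (Or.inl ⟨hp, hL⟩)]
      simp
    | some L =>
      have hc : (cluster M ℓ L).card ≤ 2 * b * (proposers r M i adj ℓ L).card := by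
        by_contra hc
        exact huA (Finset.mem_filter.2 ⟨huM, L, hp, not_le.1 hc⟩)
      rw [hℓ', globalStep_eq_some.2 (Or.inr ⟨hp, hc⟩)]
      simp
  have hdisj : Disjoint (stoppedNodes r M i adj ℓ) B := by
    refine Finset.disjoint_left.2 fun u hu hu' => ?_
    obtain ⟨_, L, hL, _, hs⟩ := Finset.mem_filter.1 hu
    obtain ⟨_, L', hL', _, v, hv⟩ := Finset.mem_filter.1 hu'
    rw [hL] at hL'
    cases hL'
    exact hs.proposal_ne v (Finset.mem_filter.1 hv).2
  have hsub : stoppedNodes r M i adj ℓ ∪ B ⊆ stoppedNodes r M i adj ℓ' := by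
    refine Finset.union_subset (fun u hu => ?_) fun u hu => ?_
    · obtain ⟨huM, L, hL, hb, hs⟩ := Finset.mem_filter.1 hu
      exact Finset.mem_filter.2 ⟨huM, L, globalStep_of_testBit hL hb, hb, hs.globalStep⟩
    · obtain ⟨huM, L, hL, hc, v, hv⟩ := Finset.mem_filter.1 hu
      have hb := (proposal_eq_some (Finset.mem_filter.1 hv).2).2.1
      exact Finset.mem_filter.2 ⟨huM, L, globalStep_of_testBit hL hb, hb, stopped_globalStep hb hc⟩
  have h1 := (Finset.card_le_card hliv).trans (Finset.card_union_le _ _)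
  have h2 := Finset.card_le_card hsub
  rw [Finset.card_union_of_disjoint hdisj] at h2
  have h3 := Nat.mul_le_mul_left (2 * b) h1
  rw [Nat.mul_add] at h3
  omega

/-- Labels are identifiers, and nodes are at distance at most `R` from the node that gave them the
label. -/
def LabelsWithin (M R : ℕ) (adj : ℕ → ℕ → Prop) (ℓ : ℕ → Option ℕ) : Prop :=
  ∀ v L, ℓ v = some L → v < M ∧ L < M ∧ v ∈ ball adj R L

lemma LabelsWithin.globalStep (h : LabelsWithin M R adj ℓ) (hs : ∀ ⦃u v⦄, adj u v → adj v u) :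
    LabelsWithin M (R + r) adj (globalStep r b M i adj ℓ) := by
  intro v L hv
  rcases globalStep_eq_some.1 hv with ⟨_, hv⟩ | ⟨hv, _⟩
  · obtain ⟨h1, h2, h3⟩ := h v L hv
    exact ⟨h1, h2, ball_mono (Nat.le_add_right R r) h3⟩
  · obtain ⟨⟨L₀, h0, _⟩, _, u, hu, hL⟩ := proposal_eq_some hv
    obtain ⟨_, h2, h3⟩ := h u L hL
    exact ⟨(h v L₀ h0).1, h2, mem_ball_add h3 (mem_ball_symm hs hu)⟩

/-- A proposer is within `r + 2R` of every node of the cluster it asks, hence within `2R + 2r` of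
its fellow proposers; the ball of radius `T` contains all that is counted. -/
lemma LabelsWithin.clusterStep_eq (h : LabelsWithin M R adj ℓ)
    (hs : ∀ ⦃u v⦄, adj u v → adj v u) (hT : 2 * R + 2 * r ≤ T) :
    clusterStep r b M T i adj ℓ = Distrib.globalStep r b M i adj ℓ := by
  classical
  ext1 v
  unfold clusterStep Distrib.globalStep
  cases hp : proposal r i adj ℓ v with
  | none => rfl
  | some L =>
    dsimp only
    obtain ⟨_, _, u₀, hu₀, hL⟩ := proposal_eq_some hp
    have hmem : ∀ u, ℓ u = some L → u ∈ ball adj (r + R + R) v := fun u hu =>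
      mem_ball_add (mem_ball_add hu₀ (mem_ball_symm hs (h u₀ L hL).2.2)) (h u L hu).2.2
    have e1 : ((Finset.range M).filter fun u => u ∈ ball adj T v ∧ ℓ u = some L) =
        cluster M ℓ L :=
      Finset.filter_congr fun u _ =>
        and_iff_right_of_imp fun hu => ball_mono (by omega : r + R + R ≤ T) (hmem u hu)
    have e2 : ((Finset.range M).filter fun u =>
        u ∈ ball adj T v ∧ proposal r i adj ℓ u = some L) = proposers r M i adj ℓ L := by
      refine Finset.filter_congr fun u _ => and_iff_right_of_imp fun hu => ?_
      obtain ⟨_, _, u', hu', hL'⟩ := proposal_eq_some hu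
      exact ball_mono (by omega) (mem_ball_add (hmem u' hL') (mem_ball_symm hs hu'))
    rw [e1, e2]

/-- Labels of close nodes agree on the bits below `i`. -/
def PrefixSeparated (r i : ℕ) (adj : ℕ → ℕ → Prop) (ℓ : ℕ → Option ℕ) : Prop :=
  ∀ v L, ℓ v = some L → ∀ u ∈ ball adj r v, ∀ L', ℓ u = some L' →
    ∀ j < i, L.testBit j = L'.testBit j

/-- A node changes its label only to that of a close node, which by assumption has the same lower
bits. -/
lemma PrefixSeparated.globalStep (h : PrefixSeparated r i adj ℓ) :
    PrefixSeparated r i adj (globalStep r b M i adj ℓ) := by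
  have key : ∀ v L, Distrib.globalStep r b M i adj ℓ v = some L → ∃ L₀, ℓ v = some L₀ ∧
      ∀ j < i, L.testBit j = L₀.testBit j := by
    intro v L hv
    rcases globalStep_eq_some.1 hv with ⟨_, hv⟩ | ⟨hv, _⟩
    · exact ⟨L, hv, fun _ _ => rfl⟩
    · obtain ⟨⟨L₀, h0, _⟩, _, u, hu, hL⟩ := proposal_eq_some hv
      exact ⟨L₀, h0, fun j hj => (h v L₀ h0 u hu L hL j hj).symm⟩
  intro v L hv u hu L' hu' j hj
  obtain ⟨L₀, h0, h1⟩ := key v L hv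
  obtain ⟨L₁, h2, h3⟩ := key u L' hu'
  rw [h1 j hj, h3 j hj]
  exact h v L₀ h0 u hu L₁ h2 j hj

/-- Two close nodes that differ in bit `i` would put a node with bit `0` near a stopped cluster. -/
lemma PrefixSeparated.succ (h : PrefixSeparated r i adj ℓ) (hs : ∀ ⦃u v⦄, adj u v → adj v u)
    (hst : ∀ L, L.testBit i = true → Stopped r i adj ℓ L) : PrefixSeparated r (i + 1) adj ℓ := by
  intro v L hv u hu L' hu' j hj
  rcases Nat.lt_succ_iff_lt_or_eq.1 hj with hj | rfl
  · exact h v L hv u hu L' hu' j hj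
  · cases hL : L.testBit j with
    | true => exact (hst L hL u L' hu' v (mem_ball_symm hs hu) hv).symm
    | false =>
      cases hL' : L'.testBit j with
      | false => rfl
      | true => rw [hst L' hL' v L hv u hu hu'] at hL; exact hL.symm

/-- A cluster that has not stopped has accepted in every step, so its size is at least `(1 +
1/(2b))^t`. A cluster that is empty at the start counts as stopped. -/
lemma stopped_or_card_le (hw : LabelsWithin M R adj ℓ) (hL : L.testBit i = true) (t : ℕ) :
    Stopped r i adj ((globalStep r b M i adj)^[t] ℓ) L ∨
      (2 * b + 1) ^ t ≤ (2 * b) ^ t * (cluster M ((globalStep r b M i adj)^[t] ℓ) L).card := by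
  induction t with
  | zero =>
    by_cases hc : (cluster M ℓ L).Nonempty
    · exact Or.inr (by simpa using hc)
    · refine Or.inl fun v L₀ _ u _ hu => absurd ⟨u, ?_⟩ hc
      exact Finset.mem_filter.2 ⟨Finset.mem_range.2 (hw u L hu).1, hu⟩
  | succ t ih =>
    rw [Function.iterate_succ_apply']
    set ℓ' := (globalStep r b M i adj)^[t] ℓ
    rcases ih with ih | ih
    · exact Or.inl ih.globalStep
    · by_cases hc : (cluster M ℓ' L).card ≤ 2 * b * (proposers r M i adj ℓ' L).card
      · refine Or.inr ?_
        have h := card_cluster_globalStep hL hc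
        calc (2 * b + 1) ^ (t + 1) = (2 * b + 1) * (2 * b + 1) ^ t := by ring
          _ ≤ (2 * b + 1) * ((2 * b) ^ t * (cluster M ℓ' L).card) := Nat.mul_le_mul_left _ ih
          _ = (2 * b) ^ t * ((2 * b + 1) * (cluster M ℓ' L).card) := by ring
          _ ≤ (2 * b) ^ t * (2 * b * (cluster M (globalStep r b M i adj ℓ') L).card) :=
            Nat.mul_le_mul_left _ h
          _ = _ := by ring
      · exact Or.inl (stopped_globalStep hL (not_le.1 hc))

lemma card_living_iterate (t : ℕ) :
    2 * b * (living M ℓ).card ≤ 2 * b * (living M ((globalStep r b M i adj)^[t] ℓ)).card +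
      (stoppedNodes r M i adj ((globalStep r b M i adj)^[t] ℓ)).card := by
  induction t with
  | zero => exact Nat.le_add_right _ _
  | succ t ih =>
    rw [Function.iterate_succ_apply']
    exact ih.trans card_living_globalStep

lemma living_globalStep_subset : living M (globalStep r b M i adj ℓ) ⊆ living M ℓ := by
  intro u hu
  obtain ⟨hM, hu⟩ := Finset.mem_filter.1 hu
  refine Finset.mem_filter.2 ⟨hM, fun h => hu ?_⟩
  by_contra hne
  obtain ⟨L, hL⟩ := Option.ne_none_iff_exists'.1 hne
  rcases globalStep_eq_some.1 hL with ⟨_, hL⟩ | ⟨hL, _⟩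
  · rw [h] at hL; cases hL
  · obtain ⟨⟨L₀, h0, _⟩, _⟩ := proposal_eq_some hL
    rw [h] at h0; cases h0

lemma stoppedNodes_subset_living : stoppedNodes r M i adj ℓ ⊆ living M ℓ := by
  classical
  intro u hu
  obtain ⟨hM, L, hL, _⟩ := Finset.mem_filter.1 hu
  exact Finset.mem_filter.2 ⟨hM, by rw [hL]; simp⟩

end Step

/-- The number of steps of a phase of the clustering algorithm. -/
def phaseLength (b : ℕ) : ℕ := 2 * b * b

/-- Bernoulli's inequality `(1 + 1/x)^n ≥ 1 + n/x`, multiplied by `x^(n+1)`. -/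
lemma pow_mul_add_le (x n : ℕ) : x ^ n * (x + n) ≤ (x + 1) ^ n * x := by
  induction n with
  | zero => simp
  | succ n ih =>
    calc x ^ (n + 1) * (x + (n + 1)) ≤ (x + 1) * (x ^ n * (x + n)) := by
          have h : (x + 1) * (x ^ n * (x + n)) = x ^ (n + 1) * (x + (n + 1)) + x ^ n * n := by ring
          omega
      _ ≤ (x + 1) * ((x + 1) ^ n * x) := Nat.mul_le_mul_left _ ih
      _ = (x + 1) ^ (n + 1) * x := by ring

/-- Since `(1 + 1/(2b))^(2b) ≥ 2`, growth over `2b · b` steps gives a factor of at least `2^b`, more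
than the number of available identifiers. This fixes `phaseLength`. -/
lemma two_pow_mul_le (b : ℕ) : 2 ^ b * (2 * b) ^ phaseLength b ≤ (2 * b + 1) ^ phaseLength b := by
  rcases Nat.eq_zero_or_pos b with rfl | hb
  · simp [phaseLength]
  have h : 2 * (2 * b) ^ (2 * b) ≤ (2 * b + 1) ^ (2 * b) := by
    have h := pow_mul_add_le (2 * b) (2 * b)
    refine Nat.le_of_mul_le_mul_right (c := 2 * b) ?_ (by omega)
    calc _ = (2 * b) ^ (2 * b) * (2 * b + 2 * b) := by ring
      _ ≤ _ := h
  rw [phaseLength, pow_mul (2 * b) (2 * b) b, pow_mul (2 * b + 1) (2 * b) b, ← mul_pow]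
  exact Nat.pow_le_pow_left h b

/-! ### A whole phase, devoted to one bit -/

section Phase
variable {r b M i R T : ℕ} {adj : ℕ → ℕ → Prop} {ℓ : ℕ → Option ℕ}

lemma stopped_iterate_phaseLength (hw : LabelsWithin M R adj ℓ) (hM : M < 2 ^ b) (hb : 0 < b)
    {L : ℕ} (hL : L.testBit i = true) :
    Stopped r i adj ((globalStep r b M i adj)^[phaseLength b] ℓ) L := by
  refine (stopped_or_card_le hw hL (phaseLength b)).resolve_right fun h => ?_
  have h1 : (cluster M ((globalStep r b M i adj)^[phaseLength b] ℓ) L).card ≤ M :=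
    (Finset.card_filter_le _ _).trans (Finset.card_range M).le
  have h2 := (two_pow_mul_le b).trans h
  rw [Nat.mul_comm] at h2
  have h3 := Nat.le_of_mul_le_mul_left h2 (by positivity)
  omega

lemma living_iterate_subset (t : ℕ) :
    living M ((globalStep r b M i adj)^[t] ℓ) ⊆ living M ℓ := by
  induction t with
  | zero => exact subset_rfl
  | succ t ih =>
    rw [Function.iterate_succ_apply']
    exact living_globalStep_subset.trans ih

lemma PrefixSeparated.iterate (h : PrefixSeparated r i adj ℓ) (t : ℕ) :
    PrefixSeparated r i adj ((Distrib.globalStep r b M i adj)^[t] ℓ) := by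
  induction t with
  | zero => exact h
  | succ t ih =>
    rw [Function.iterate_succ_apply']
    exact ih.globalStep

lemma LabelsWithin.iterate (h : LabelsWithin M R adj ℓ) (hs : ∀ ⦃u v⦄, adj u v → adj v u) (t : ℕ)
    (hT : 2 * (R + r * t) ≤ T) :
    (clusterStep r b M T i adj)^[t] ℓ = (Distrib.globalStep r b M i adj)^[t] ℓ ∧
      LabelsWithin M (R + r * t) adj ((clusterStep r b M T i adj)^[t] ℓ) := by
  induction t with
  | zero => exact ⟨rfl, h⟩
  | succ t ih =>
    rw [Nat.mul_succ] at hT ⊢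
    obtain ⟨h1, h2⟩ := ih (by omega)
    rw [Function.iterate_succ_apply', Function.iterate_succ_apply', ← h1,
      h2.clusterStep_eq hs (by omega), ← Nat.add_assoc]
    exact ⟨rfl, h2.globalStep hs⟩

end Phase

/-- The result of the first `k` phases of the clustering algorithm. -/
noncomputable def clusterPhases (r b M T : ℕ) (adj : ℕ → ℕ → Prop) (ℓ : ℕ → Option ℕ) :
    ℕ → ℕ → Option ℕ
  | 0 => ℓ
  | i + 1 => (clusterStep r b M T i adj)^[phaseLength b] (clusterPhases r b M T adj ℓ i)

/-- The bound on the distance of a node from the node that gave it its label. -/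
def clusterRadius (r b : ℕ) : ℕ := r * phaseLength b * b

/-- The label of the cluster of each node that is kept, if the nodes initially have the labels `ℓ`. -/
noncomputable def clustering (r b M : ℕ) (adj : ℕ → ℕ → Prop) (ℓ : ℕ → Option ℕ) : ℕ → Option ℕ :=
  clusterPhases r b M (2 * clusterRadius r b) adj ℓ b

lemma isLocal_clusterPhases (r b M T k : ℕ) :
    IsLocal (k * (phaseLength b * (T + r))) fun adj ℓ => clusterPhases r b M T adj ℓ k := by
  induction k with
  | zero => exact (IsLocal.label id).mono (Nat.zero_le _)
  | succ k ih =>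
    exact (((isLocal_clusterStep r b M T k).iterate (phaseLength b)).comp ih).mono
      (by rw [Nat.succ_mul, Nat.add_comm])

lemma isLocal_clustering (r b M : ℕ) :
    IsLocal (b * (phaseLength b * (2 * clusterRadius r b + r))) (clustering r b M) :=
  isLocal_clusterPhases r b M _ b

/-- Each phase adds `r * phaseLength b` to the radius, separates one more bit, and loses at most a
`1/(2b)` fraction of the initial nodes, because the stopped nodes that pay for the losses are
initial nodes themselves. -/
lemma clusterPhases_spec {r b M : ℕ} {adj : ℕ → ℕ → Prop} {ℓ : ℕ → Option ℕ}
    (hs : ∀ ⦃u v⦄, adj u v → adj v u) (hM : M < 2 ^ b) (hb : 0 < b)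
    (hw : LabelsWithin M 0 adj ℓ) (k : ℕ) (hk : k ≤ b) :
    LabelsWithin M (r * phaseLength b * k) adj
        (clusterPhases r b M (2 * clusterRadius r b) adj ℓ k) ∧
      PrefixSeparated r k adj (clusterPhases r b M (2 * clusterRadius r b) adj ℓ k) ∧
      living M (clusterPhases r b M (2 * clusterRadius r b) adj ℓ k) ⊆ living M ℓ ∧
      2 * b * (living M ℓ).card ≤
        2 * b * (living M (clusterPhases r b M (2 * clusterRadius r b) adj ℓ k)).card +
          k * (living M ℓ).card := by
  induction k with
  | zero =>
    exact ⟨hw, fun _ _ _ _ _ _ _ j hj => absurd hj (Nat.not_lt_zero j), subset_rfl,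
      Nat.le_add_right _ _⟩
  | succ k ih =>
    obtain ⟨h1, h2, h3, h4⟩ := ih (by omega)
    have hT : 2 * (r * phaseLength b * k + r * phaseLength b) ≤ 2 * clusterRadius r b := by
      refine Nat.mul_le_mul_left 2 ?_
      rw [← Nat.mul_succ]
      exact Nat.mul_le_mul_left _ hk
    obtain ⟨h5, h6⟩ := h1.iterate (i := k) (b := b) hs (phaseLength b) hT
    simp only [clusterPhases]
    set ℓ' := clusterPhases r b M (2 * clusterRadius r b) adj ℓ k
    rw [Nat.mul_succ]
    refine ⟨h6, ?_⟩
    rw [h5]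
    refine ⟨(h2.iterate _).succ hs fun L hL => stopped_iterate_phaseLength h1 hM hb hL,
      (living_iterate_subset _).trans h3, ?_⟩
    have h7 := card_living_iterate (r := r) (b := b) (M := M) (i := k) (adj := adj) (ℓ := ℓ')
      (phaseLength b)
    have h8 : (stoppedNodes r M k adj ((globalStep r b M k adj)^[phaseLength b] ℓ')).card ≤
        (living M ℓ).card :=
      Finset.card_le_card
        (stoppedNodes_subset_living.trans ((living_iterate_subset _).trans h3))
    rw [Nat.succ_mul k]
    omega

/-- The clustering keeps at least half of the nodes, its clusters have bounded weak radius, and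
nodes at distance at most `r` are in the same cluster. -/
theorem clustering_spec {r b M : ℕ} {adj : ℕ → ℕ → Prop} {ℓ : ℕ → Option ℕ}
    (hs : ∀ ⦃u v⦄, adj u v → adj v u) (hM : M < 2 ^ b) (hℓ : ∀ v L, ℓ v = some L → v < M ∧ L = v) :
    LabelsWithin M (clusterRadius r b) adj (clustering r b M adj ℓ) ∧
      (∀ v L, clustering r b M adj ℓ v = some L → ∀ u ∈ ball adj r v, ∀ L',
        clustering r b M adj ℓ u = some L' → L = L') ∧
      living M (clustering r b M adj ℓ) ⊆ living M ℓ ∧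
      (living M ℓ).card ≤ 2 * (living M (clustering r b M adj ℓ)).card := by
  have hw : LabelsWithin M 0 adj ℓ := by
    intro v L h
    obtain ⟨h1, rfl⟩ := hℓ v L h
    exact ⟨h1, h1, mem_ball_self⟩
  rcases Nat.eq_zero_or_pos b with rfl | hb
  · have hnone : ∀ v L, ℓ v ≠ some L := fun v L h => by
      have := (hℓ v L h).1
      simp at hM
      omega
    refine ⟨hw, fun v L h => absurd h (hnone v L), subset_rfl, ?_⟩
    have h0 : (living M ℓ) = ∅ := Finset.filter_eq_empty_iff.2 fun v _ h => by
      obtain ⟨L, hL⟩ := Option.ne_none_iff_exists'.1 h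
      exact hnone v L hL
    rw [h0]
    exact Nat.zero_le _
  obtain ⟨h1, h2, h3, h4⟩ := clusterPhases_spec (r := r) hs hM hb hw b le_rfl
  refine ⟨h1, fun v L hv u hu L' hu' => ?_, h3, ?_⟩
  · refine Nat.eq_of_testBit_eq fun j => ?_
    by_cases hj : j < b
    · exact h2 v L hv u hu L' hu' j hj
    · have hpow : 2 ^ b ≤ 2 ^ j := Nat.pow_le_pow_right (by omega) (by omega)
      have hL := (h1 v L hv).2.1
      have hL' := (h1 u L' hu').2.1
      rw [Nat.testBit_lt_two_pow (by omega), Nat.testBit_lt_two_pow (by omega)]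
  · refine Nat.le_of_mul_le_mul_left (c := b) ?_ hb
    have e1 : 2 * b * (living M ℓ).card = b * (living M ℓ).card + b * (living M ℓ).card := by ring
    have e2 : b * (2 * (living M (clustering r b M adj ℓ)).card) =
      2 * b * (living M (clustering r b M adj ℓ)).card := by ring
    have h5 : 2 * b * (living M ℓ).card ≤
      2 * b * (living M (clustering r b M adj ℓ)).card + b * (living M ℓ).card := h4
    omega

/-! ### Polylogarithmic functions -/

namespace IsPolylog
variable {f g : ℕ → ℕ}

lemma const (c : ℕ) : IsPolylog fun _ => c :=
  ⟨c, fun _ => Nat.le_mul_of_pos_right _ (by positivity)⟩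

lemma log : IsPolylog fun n => Nat.log 2 n + 1 := ⟨1, fun n => by simp⟩

lemma mul (hf : IsPolylog f) (hg : IsPolylog g) : IsPolylog fun n => f n * g n := by
  obtain ⟨c, hc⟩ := hf
  obtain ⟨d, hd⟩ := hg
  -- A single constant has to bound both the factor `c * d` and the exponent `c + d`.
  refine ⟨c * d + c + d, fun n => (Nat.mul_le_mul (hc n) (hd n)).trans ?_⟩
  calc _ = c * d * (Nat.log 2 n + 1) ^ (c + d) := by ring
    _ ≤ _ := Nat.mul_le_mul (by omega) (Nat.pow_le_pow_right (by omega)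
      (by rw [Nat.add_assoc]; exact Nat.le_add_left _ _))

lemma add (hf : IsPolylog f) (hg : IsPolylog g) : IsPolylog fun n => f n + g n := by
  obtain ⟨c, hc⟩ := hf
  obtain ⟨d, hd⟩ := hg
  refine ⟨c + d, fun n => (Nat.add_le_add (hc n) (hd n)).trans ?_⟩
  rw [Nat.add_mul]
  exact Nat.add_le_add
    (Nat.mul_le_mul_left _ (Nat.pow_le_pow_right (by omega) (Nat.le_add_right _ _)))
    (Nat.mul_le_mul_left _ (Nat.pow_le_pow_right (by omega) (Nat.le_add_left _ _)))

end IsPolylog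

/-! ### Simulating SLOCAL algorithms in the LOCAL model -/

section Simulation
variable {I S : Type}

open Classical in
/-- Each node that has not been processed labelled with its identifier. -/
noncomputable def unprocessedLabel (y : ℕ → Option I × Option S) (u : ℕ) : Option ℕ :=
  if (y u).1 ≠ none ∧ (y u).2 = none then some u else none

open Classical in
/-- Cluster the nodes that have not been processed, and process each cluster in the order of the
identifiers. -/
noncomputable def colourStep (f : View I S → S) (r b M : ℕ) (adj : ℕ → ℕ → Prop)
    (y : ℕ → Option I × Option S) (v : ℕ) : Option I × Option S :=
  ((y v).1,
    match clustering r b M adj (unprocessedLabel y) v with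
    | none => (y v).2
    | some L => idRun f adj (fun u => (y u).1) r (fun u => (y u).2)
        ((List.range M).filter fun u => u ∈ ball adj (2 * clusterRadius r b) v ∧
          clustering r b M adj (unprocessedLabel y) u = some L) v)

/-- A bound on the locality of `colourStep`. -/
def colourLocality (r b : ℕ) : ℕ :=
  2 * clusterRadius r b + r + b * (phaseLength b * (2 * clusterRadius r b + r))

lemma isLocal_colourStep (f : View I S → S) (r b M : ℕ) :
    IsLocal (colourLocality r b) (colourStep f r b M) := by
  classical
  intro adj adj' y y' v h
  have hc : IsLocal (b * (phaseLength b * (2 * clusterRadius r b + r)))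
      fun adj (y : ℕ → Option I × Option S) => clustering r b M adj (unprocessedLabel y) := by
    refine (isLocal_clustering r b M).comp (t := 0) (F := fun _ y => unprocessedLabel y) ?_
    intro adj adj' y y' v h
    simp only [unprocessedLabel, h.label]
  have hc' : ∀ u ∈ ball adj (2 * clusterRadius r b) v,
      clustering r b M adj (unprocessedLabel y) u =
        clustering r b M adj' (unprocessedLabel y') u := fun u hu =>
    hc ((h.mono (s := 2 * clusterRadius r b + _) (by rw [colourLocality]; omega)).of_mem hu)
  unfold colourStep
  rw [← hc' v mem_ball_self, h.label]
  congr 1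
  cases clustering r b M adj (unprocessedLabel y) v with
  | none => rfl
  | some L =>
    dsimp only
    have hl : ((List.range M).filter fun u => u ∈ ball adj (2 * clusterRadius r b) v ∧
          clustering r b M adj (unprocessedLabel y) u = some L) =
        (List.range M).filter fun u => u ∈ ball adj' (2 * clusterRadius r b) v ∧
          clustering r b M adj' (unprocessedLabel y') u = some L := by
      refine List.filter_congr fun u _ => ?_
      rw [← h.ball_eq (by rw [colourLocality]; omega)]
      exact decide_eq_decide.2 (and_congr_right fun hu => by rw [hc' u hu])
    rw [← hl]
    refine idRun_congr f (D := 2 * clusterRadius r b) (fun u hu => ?_)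
      (h.mono (by rw [colourLocality]; omega))
    simpa using (of_decide_eq_true (List.mem_filter.1 hu).2).1

open Classical in
/-- The nodes that have not been processed. -/
noncomputable def unprocessed (M : ℕ) (x : ℕ → Option I) (s : ℕ → Option S) : Finset ℕ :=
  (Finset.range M).filter fun u => x u ≠ none ∧ s u = none

/-- The parallel processing of the clusters equals a sequential run over all clustered nodes in the
order of identifiers, because clusters cannot see each other. At least half of the unprocessed nodes
are clustered. -/
lemma colourStep_spec (f : View I S → S) {r b M : ℕ} {adj : ℕ → ℕ → Prop}
    (hs : ∀ ⦃u v⦄, adj u v → adj v u) (hM : M < 2 ^ b) {x : ℕ → Option I}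
    (hx : ∀ u, x u ≠ none → u < M) (s : ℕ → Option S) :
    ∃ l : List ℕ, l.Nodup ∧ (∀ u ∈ l, x u ≠ none ∧ s u = none) ∧
      (colourStep f r b M adj fun u => (x u, s u)) =
        (fun u => (x u, idRun f adj x r s l u)) ∧
      2 * (unprocessed M x (idRun f adj x r s l)).card ≤ (unprocessed M x s).card := by
  classical
  have hinit : ∀ v L, unprocessedLabel (fun u => (x u, s u)) v = some L →
      (x v ≠ none ∧ s v = none) ∧ L = v := by
    intro v L h
    unfold unprocessedLabel at h
    split_ifs at h with hv
    exact ⟨hv, (Option.some.inj h).symm⟩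
  obtain ⟨h1, h2, h3, h4⟩ := clustering_spec (r := r) hs hM
    (ℓ := unprocessedLabel fun u => (x u, s u))
    fun v L h => ⟨hx v (hinit v L h).1.1, (hinit v L h).2⟩
  set ℓ := clustering r b M adj (unprocessedLabel fun u => (x u, s u)) with hℓ
  have hliv : living M (unprocessedLabel fun u => (x u, s u)) = unprocessed M x s := by
    refine Finset.filter_congr fun u _ => ?_
    unfold unprocessedLabel
    split_ifs with h
    · simpa using h
    · simpa using h
  rw [hliv] at h3 h4
  set l := (List.range M).filter fun u => ℓ u ≠ none with hl
  have hmem : ∀ u, u ∈ l ↔ ℓ u ≠ none := by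
    intro u
    rw [hl, List.mem_filter, List.mem_range, decide_eq_true_iff]
    refine and_iff_right_of_imp fun h => ?_
    obtain ⟨L, hL⟩ := Option.ne_none_iff_exists'.1 h
    exact (h1 u L hL).1
  have hlM : ∀ u, ℓ u ≠ none → u ∈ living M ℓ := fun u hu => by
    obtain ⟨L, hL⟩ := Option.ne_none_iff_exists'.1 hu
    exact Finset.mem_filter.2 ⟨Finset.mem_range.2 (h1 u L hL).1, hu⟩
  refine ⟨l, List.Nodup.filter _ List.nodup_range, fun u hu => ?_, ?_, ?_⟩
  · exact (Finset.mem_filter.1 (h3 (hlM u ((hmem u).1 hu)))).2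
  · ext1 v
    unfold colourStep
    refine Prod.ext rfl ?_
    rw [← hℓ]
    cases hv : ℓ v with
    | none => exact (idRun_of_notMem f fun h => (hmem v).1 h hv).symm
    | some L =>
      have hvl : v ∈ l := (hmem v).2 (by rw [hv]; simp)
      dsimp only
      rw [idRun_filter f (fun u => decide (ℓ u = some L)) (fun u _ w hw hu hwu => ?_)
        (decide_eq_true hv) hvl, hl, List.filter_filter]
      · congr 1
        refine List.filter_congr fun u _ => ?_
        rw [← Bool.decide_and]
        refine decide_eq_decide.2 ⟨fun h => ⟨h.2, by rw [h.2]; simp⟩, fun h => ⟨?_, h.1⟩⟩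
        -- Two nodes of a cluster are each within the cluster radius of the node that gave the
        -- label.
        have := mem_ball_add (mem_ball_symm hs (h1 v L hv).2.2) (h1 u L h.1).2.2
        rwa [← Nat.two_mul] at this
      · obtain ⟨L', hL'⟩ := Option.ne_none_iff_exists'.1 ((hmem w).1 hw)
        rw [decide_eq_true_iff] at hu ⊢
        rw [hL', h2 u L hu w hwu L' hL']
  · have hd : Disjoint (unprocessed M x (idRun f adj x r s l)) (living M ℓ) := by
      refine Finset.disjoint_left.2 fun u hu hu' => ?_
      exact idRun_ne_none_of_mem f (Or.inr ((hmem u).2 (Finset.mem_filter.1 hu').2))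
        (Finset.mem_filter.1 hu).2.2
    have hsub : unprocessed M x (idRun f adj x r s l) ∪ living M ℓ ⊆ unprocessed M x s := by
      refine Finset.union_subset (fun u hu => ?_) h3
      obtain ⟨h5, h6, h7⟩ := Finset.mem_filter.1 hu
      refine Finset.mem_filter.2 ⟨h5, h6, ?_⟩
      by_contra h
      exact idRun_ne_none_of_mem f (Or.inl h) h7
    have h5 := Finset.card_le_card hsub
    rw [Finset.card_union_of_disjoint hd] at h5
    omega

/-- The sequential runs of the successive steps concatenate to one run, without repetition since
each step handles only unprocessed nodes. -/
lemma colourStep_iterate_spec (f : View I S → S) {r b M : ℕ} {adj : ℕ → ℕ → Prop}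
    (hs : ∀ ⦃u v⦄, adj u v → adj v u) (hM : M < 2 ^ b) {x : ℕ → Option I}
    (hx : ∀ u, x u ≠ none → u < M) (k : ℕ) :
    ∃ l : List ℕ, l.Nodup ∧ (∀ u ∈ l, x u ≠ none) ∧
      ((colourStep f r b M adj)^[k] fun u => (x u, none)) =
        (fun u => (x u, idRun f adj x r (fun _ => none) l u)) ∧
      2 ^ k * (unprocessed M x (idRun f adj x r (fun _ => none) l)).card ≤ M := by
  induction k with
  | zero =>
    refine ⟨[], List.nodup_nil, by simp, rfl, ?_⟩
    rw [pow_zero, Nat.one_mul]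
    exact (Finset.card_filter_le _ _).trans (Finset.card_range M).le
  | succ k ih =>
    obtain ⟨l, h1, h2, h3, h4⟩ := ih
    obtain ⟨l', h5, h6, h7, h8⟩ := colourStep_spec f (r := r) hs hM hx
      (idRun f adj x r (fun _ => none) l)
    refine ⟨l ++ l', ?_, ?_, ?_, ?_⟩
    · refine List.nodup_append.2 ⟨h1, h5, fun u hu w hw h => ?_⟩
      subst h
      exact idRun_ne_none_of_mem f (Or.inr hu) (h6 u hw).2
    · intro u hu
      rcases List.mem_append.1 hu with hu | hu
      · exact h2 u hu
      · exact (h6 u hu).1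
    · rw [Function.iterate_succ_apply', h3, h7, idRun_append]
    · rw [idRun_append, pow_succ, Nat.mul_assoc]
      exact (Nat.mul_le_mul_left _ h8).trans h4

/-- The state of each node in an execution of an SLOCAL algorithm with locality `r` that is computed
by repeated clustering. -/
noncomputable def simulatedState (f : View I S → S) (r b M : ℕ) (adj : ℕ → ℕ → Prop)
    (x : ℕ → Option I) (v : ℕ) : S :=
  -- The default value only provides some element of `S`; after `b` steps every node of the network
  -- has a state.
  (((colourStep f r b M adj)^[b] fun u => (x u, none)) v).2.getD (f ⟨v, ∅, ∅⟩)

lemma isLocal_simulatedState (f : View I S → S) (r b M : ℕ) :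
    IsLocal (b * colourLocality r b) (simulatedState f r b M) := by
  intro adj adj' x x' v h
  have h1 : (colourStep f r b M adj)^[b] (fun u => (x u, none)) v =
      (colourStep f r b M adj')^[b] (fun u => (x' u, none)) v :=
    (isLocal_colourStep f r b M).iterate b fun u hu => ⟨Prod.ext (h u hu).1 rfl, (h u hu).2⟩
  unfold simulatedState
  rw [h1]

lemma simulatedState_spec (f : View I S → S) {r b M : ℕ} {adj : ℕ → ℕ → Prop}
    (hs : ∀ ⦃u v⦄, adj u v → adj v u) (hM : M < 2 ^ b) {x : ℕ → Option I}
    (hx : ∀ u, x u ≠ none → u < M) :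
    ∃ l : List ℕ, l.Nodup ∧ (∀ u, u ∈ l ↔ x u ≠ none) ∧ ∀ u, x u ≠ none →
      idRun f adj x r (fun _ => none) l u = some (simulatedState f r b M adj x u) := by
  obtain ⟨l, h1, h2, h3, h4⟩ := colourStep_iterate_spec f (r := r) hs hM hx b
  have h5 : unprocessed M x (idRun f adj x r (fun _ => none) l) = ∅ := by
    rw [← Finset.card_eq_zero]
    by_contra h
    have := Nat.le_mul_of_pos_right (2 ^ b) (Nat.pos_of_ne_zero h)
    omega
  have h6 : ∀ u, x u ≠ none → idRun f adj x r (fun _ => none) l u ≠ none := fun u hu h =>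
    Finset.eq_empty_iff_forall_notMem.1 h5 u
      (Finset.mem_filter.2 ⟨Finset.mem_range.2 (hx u hu), hu, h⟩)
  refine ⟨l, h1, fun u => ⟨h2 u, fun hu => ?_⟩, fun u hu => ?_⟩
  · by_contra hul
    exact h6 u hu (idRun_of_notMem f hul)
  · obtain ⟨s, hs⟩ := Option.ne_none_iff_exists'.1 (h6 u hu)
    unfold simulatedState
    rw [h3]
    dsimp only
    rw [hs]
    rfl

end Simulation

lemma pow_add_one_lt_two_pow (n a : ℕ) : n ^ a + 1 < 2 ^ (a * (Nat.log 2 n + 1) + 2) := by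
  have h : n ^ a ≤ 2 ^ (a * (Nat.log 2 n + 1)) := by
    rw [Nat.mul_comm, pow_mul]
    exact Nat.pow_le_pow_left (Nat.lt_pow_succ_log_self (by omega) n).le a
  have h1 : 0 < 2 ^ (a * (Nat.log 2 n + 1)) := by positivity
  rw [pow_add]
  omega

lemma Network.lt_of_idLabel_ne_none {V I β : Type} [Fintype V] {N : Network V I} {a : ℕ}
    (hN : N.IdsOK a) {x : V → β} {i : ℕ} (h : N.idLabel x i ≠ none) :
    i < Fintype.card V ^ a + 1 := by
  obtain ⟨b, hb⟩ := Option.ne_none_iff_exists'.1 h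
  obtain ⟨v, rfl, _⟩ := (idLabel_eq_some hN.1).1 hb
  exact Nat.lt_succ_of_le (hN.2 v).2

/-- Every problem with an SLOCAL algorithm of polylogarithmic locality has a polylogarithmic time
LOCAL algorithm. -/
theorem PSLocal.pLocal {I O : Type} {P : GraphProblem I O} (hP : PSLocal P) : PLocal P := by
  intro a
  obtain ⟨A, hA, hsol⟩ := hP a
  -- The number of bits for identifiers below `M = n ^ a + 1`, large enough that `M < 2 ^ b`.
  let b : ℕ → ℕ := fun n => a * (Nat.log 2 n + 1) + 2
  have hb : IsPolylog b := ((IsPolylog.const a).mul IsPolylog.log).add (IsPolylog.const 2)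
  have hph : IsPolylog fun n => phaseLength (b n) := ((IsPolylog.const 2).mul hb).mul hb
  have hrad : IsPolylog fun n => clusterRadius (A.locality n) (b n) := (hA.mul hph).mul hb
  have hdiam := (IsPolylog.const 2).mul hrad
  have hcol : IsPolylog fun n => colourLocality (A.locality n) (b n) :=
    (hdiam.add hA).add (hb.mul (hph.mul (hdiam.add hA)))
  refine ⟨gatherAlg (fun n => b n * colourLocality (A.locality n) (b n)) fun n adj x v =>
    A.out (simulatedState (A.process n) (A.locality n) (b n) (n ^ a + 1) adj x v),
    (hb.mul hcol).add (IsPolylog.const 1), ?_⟩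
  intro V _ N hN hdom
  set n := Fintype.card V with hn
  obtain ⟨l, hl, hmem, hrun⟩ := simulatedState_spec (A.process n) (r := A.locality n)
    (b := b n) (N.idAdj_symm) (pow_add_one_lt_two_pow n a) (x := N.idLabel N.input)
    fun u hu => Network.lt_of_idLabel_ne_none hN hu
  have hid : ∀ v, N.idLabel N.input (N.ident v) ≠ none := fun v => by
    rw [Network.idLabel_ident hN.1]; simp
  obtain ⟨l', rfl⟩ : ∃ l' : List V, l'.map N.ident = l := by
    rw [← Set.mem_range, Set.range_list_map]
    intro i hi
    obtain ⟨b, hb⟩ := Option.ne_none_iff_exists'.1 ((hmem i).1 hi)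
    obtain ⟨v, hv, _⟩ := (Network.idLabel_eq_some hN.1).1 hb
    exact ⟨v, hv⟩
  -- The simulated order is not known in advance; correctness for every order is what makes it
  -- usable.
  obtain ⟨y, hy, hsolved⟩ := hsol N hN hdom l' (List.Nodup.of_map _ hl) fun v => by
    have := (hmem (N.ident v)).2 (hid v)
    exact (List.mem_map_of_injective hN.1).1 this
  convert hsolved using 1
  ext1 v
  rw [gatherAlg_output _ _ N hN.1]
  · have h := hy v
    rw [A.runFrom_eq_idRun hN.1 l' (s' := fun _ => none) (fun _ => rfl), hrun _ (hid v)] at h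
    exact Option.some.inj h
  · exact fun adj adj' x x' v h => congrArg A.out (isLocal_simulatedState _ _ _ _ h)

/-! ### Conditional expectations for random colour classes -/

/-- The probability that exactly one element of `e` is chosen, if `u` is chosen independently with
probability `π u`. -/
noncomputable def uniqueProb (e : Finset ℕ) (π : ℕ → ℝ) : ℝ :=
  ∑ u ∈ e, π u * ∏ w ∈ e.erase u, (1 - π w)

/-- The probability that no colour in `C` is held by exactly one element of `e`, if `u` gets colour
`c` independently with probability `π c u`. -/
noncomputable def failProb (e C : Finset ℕ) (π : ℕ → ℕ → ℝ) : ℝ :=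
  ∏ c ∈ C, (1 - uniqueProb e (π c))

open Classical in
/-- The probabilities after `v` has chosen the set `A` of colours. -/
noncomputable def commit (π : ℕ → ℕ → ℝ) (v : ℕ) (A : Finset ℕ) (c : ℕ) : ℕ → ℝ :=
  Function.update (π c) v (if c ∈ A then 1 else 0)

section Prob
variable {e C : Finset ℕ} {v : ℕ}

lemma uniqueProb_congr {π π' : ℕ → ℝ} (h : ∀ u ∈ e, π u = π' u) :
    uniqueProb e π = uniqueProb e π' := by
  refine Finset.sum_congr rfl fun u hu => ?_
  rw [h u hu, Finset.prod_congr rfl fun w hw => by rw [h w (Finset.mem_of_mem_erase hw)]]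

lemma failProb_congr {π π' : ℕ → ℕ → ℝ} (h : ∀ c ∈ C, ∀ u ∈ e, π c u = π' c u) :
    failProb e C π = failProb e C π' :=
  Finset.prod_congr rfl fun c hc => by rw [uniqueProb_congr (h c hc)]

/-- Either `v` is chosen and nobody else, or `v` is not chosen and `e` has a unique chosen element.
-/
lemma uniqueProb_insert {π : ℕ → ℝ} (hv : v ∉ e) :
    uniqueProb (insert v e) π =
      π v * ∏ w ∈ e, (1 - π w) + (1 - π v) * uniqueProb e π := by
  unfold uniqueProb
  rw [Finset.sum_insert hv, Finset.erase_insert hv, Finset.mul_sum]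
  congr 1
  refine Finset.sum_congr rfl fun u hu => ?_
  have huv : v ≠ u := fun h => hv (h ▸ hu)
  rw [Finset.erase_insert_of_ne huv,
    Finset.prod_insert fun h => hv (Finset.mem_of_mem_erase h)]
  ring

lemma uniqueProb_eq_average (π : ℕ → ℝ) (v : ℕ) :
    uniqueProb e π = π v * uniqueProb e (Function.update π v 1) +
      (1 - π v) * uniqueProb e (Function.update π v 0) := by
  by_cases hv : v ∈ e
  · have hu : ∀ t : ℝ, ∀ w ∈ e.erase v, Function.update π v t w = π w := fun t w hw =>
      Function.update_of_ne (Finset.ne_of_mem_erase hw) _ _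
    have h : ∀ t : ℝ, uniqueProb e (Function.update π v t) =
        t * ∏ w ∈ e.erase v, (1 - π w) + (1 - t) * uniqueProb (e.erase v) π := by
      intro t
      rw [← Finset.insert_erase hv, uniqueProb_insert (Finset.notMem_erase v e),
        uniqueProb_congr (hu t), Function.update_self, Finset.erase_insert_eq_erase,
        Finset.erase_idem]
      congr 2
      exact Finset.prod_congr rfl fun w hw => by rw [hu t w hw]
    have h0 := h (π v)
    rw [Function.update_eq_self] at h0
    rw [h 0, h 1, h0]
    ring
  · have hu : ∀ t : ℝ, uniqueProb e (Function.update π v t) = uniqueProb e π := fun t =>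
      uniqueProb_congr fun w hw => Function.update_of_ne (ne_of_mem_of_not_mem hw hv) _ _
    rw [hu, hu]
    ring

lemma uniqueProb_le_one {π : ℕ → ℝ} (h : ∀ u, 0 ≤ π u ∧ π u ≤ 1) : uniqueProb e π ≤ 1 := by
  induction e using Finset.induction_on with
  | empty => simp [uniqueProb]
  | insert v e hv ih =>
    rw [uniqueProb_insert hv]
    have h1 : ∏ w ∈ e, (1 - π w) ≤ 1 :=
      Finset.prod_le_one (fun w _ => sub_nonneg.2 (h w).2) fun w _ => by linarith [(h w).1]
    nlinarith [mul_le_mul_of_nonneg_left h1 (h v).1,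
      mul_le_mul_of_nonneg_left ih (sub_nonneg.2 (h v).2)]

lemma failProb_nonneg {π : ℕ → ℕ → ℝ} (h : ∀ c u, 0 ≤ π c u ∧ π c u ≤ 1) :
    0 ≤ failProb e C π :=
  Finset.prod_nonneg fun c _ => sub_nonneg.2 (uniqueProb_le_one (h c))

/-- Some choice at `v` does not increase the expected number of failures. -/
lemma exists_commit_le (B : Finset ℕ) (f : ℕ → Finset ℕ) (C : Finset ℕ) (π : ℕ → ℕ → ℝ)
    (h : ∀ c, 0 ≤ π c v ∧ π c v ≤ 1) :
    ∃ A ⊆ C, ∑ e ∈ B, failProb (f e) C (commit π v A) ≤ ∑ e ∈ B, failProb (f e) C π := by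
  classical
  -- The probability that independent choices give `v` exactly the colours in `A`. Averaged with
  -- these weights, the conditional expectations give the present one, so not all of them can exceed
  -- it.
  let W : Finset ℕ → ℝ := fun A => (∏ c ∈ A, π c v) * ∏ c ∈ C \ A, (1 - π c v)
  have hW : ∑ A ∈ C.powerset, W A = 1 := by
    rw [← Finset.prod_add]
    simp
  have hW0 : ∀ A, 0 ≤ W A := fun A => mul_nonneg (Finset.prod_nonneg fun c _ => (h c).1)
    (Finset.prod_nonneg fun c _ => sub_nonneg.2 (h c).2)
  have havg : ∀ e, ∑ A ∈ C.powerset, W A * failProb e C (commit π v A) = failProb e C π := by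
    intro e
    have h1 : failProb e C π = ∏ c ∈ C,
        (π c v * (1 - uniqueProb e (Function.update (π c) v 1)) +
          (1 - π c v) * (1 - uniqueProb e (Function.update (π c) v 0))) :=
      Finset.prod_congr rfl fun c _ => by rw [uniqueProb_eq_average (π c) v]; ring
    rw [h1, Finset.prod_add]
    refine Finset.sum_congr rfl fun A hA => ?_
    rw [failProb, ← Finset.prod_sdiff (Finset.mem_powerset.1 hA), Finset.prod_mul_distrib,
      Finset.prod_mul_distrib]
    have h2 : ∏ c ∈ A, (1 - uniqueProb e (commit π v A c)) =
        ∏ c ∈ A, (1 - uniqueProb e (Function.update (π c) v 1)) :=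
      Finset.prod_congr rfl fun c hc => by rw [commit, if_pos hc]
    have h3 : ∏ c ∈ C \ A, (1 - uniqueProb e (commit π v A c)) =
        ∏ c ∈ C \ A, (1 - uniqueProb e (Function.update (π c) v 0)) :=
      Finset.prod_congr rfl fun c hc => by rw [commit, if_neg (Finset.mem_sdiff.1 hc).2]
    rw [h2, h3]
    ring
  by_contra! hcon
  have hlt : ∑ A ∈ C.powerset, W A * ∑ e ∈ B, failProb (f e) C π <
      ∑ A ∈ C.powerset, W A * ∑ e ∈ B, failProb (f e) C (commit π v A) := by
    refine Finset.sum_lt_sum (fun A hA =>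
      mul_le_mul_of_nonneg_left (hcon A (Finset.mem_powerset.1 hA)).le (hW0 A)) ?_
    obtain ⟨A, hA, hpos⟩ : ∃ A ∈ C.powerset, W A ≠ 0 := by
      by_contra! h0
      rw [Finset.sum_eq_zero h0] at hW
      exact zero_ne_one hW
    exact ⟨A, hA, mul_lt_mul_of_pos_left (hcon A (Finset.mem_powerset.1 hA))
      (lt_of_le_of_ne (hW0 A) (Ne.symm hpos))⟩
  rw [← Finset.sum_mul, hW, one_mul] at hlt
  simp_rw [Finset.mul_sum] at hlt
  rw [Finset.sum_comm] at hlt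
  simp_rw [havg] at hlt
  exact lt_irrefl _ hlt

/-- There are at least `k` summands, each at least `1/(2Jk) · (1 - 1/(2k))^(Jk)`, and `(1 -
1/(2k))^k ≥ 1/2` by Bernoulli's inequality. -/
lemma le_uniqueProb {π : ℕ → ℝ} {k J : ℕ} (hk : 1 ≤ k) (hJ : 1 ≤ J) (h1 : k ≤ e.card)
    (h2 : e.card ≤ J * k) (hπ : ∀ u ∈ e, (2 * (J * k) : ℝ)⁻¹ ≤ π u ∧ π u ≤ (2 * k : ℝ)⁻¹) :
    (2 * J * 2 ^ J : ℝ)⁻¹ ≤ uniqueProb e π := by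
  have hk' : (1 : ℝ) ≤ k := by exact_mod_cast hk
  have hJ' : (1 : ℝ) ≤ J := by exact_mod_cast hJ
  have hq : (2 * k : ℝ)⁻¹ ≤ 1 / 2 := by
    rw [inv_le_comm₀ (by positivity) (by norm_num)]
    linarith
  have hhalf : (1 / 2 : ℝ) ≤ (1 - (2 * k : ℝ)⁻¹) ^ k := by
    have := one_add_mul_le_pow (a := -(2 * k : ℝ)⁻¹) (by linarith) k
    have h3 : (k : ℝ) * (2 * k : ℝ)⁻¹ = 1 / 2 := by field_simp
    rw [← sub_eq_add_neg] at this
    linarith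
  have hprod : ∀ u ∈ e, (1 / 2 : ℝ) ^ J ≤ ∏ w ∈ e.erase u, (1 - π w) := by
    intro u _
    calc (1 / 2 : ℝ) ^ J ≤ ((1 - (2 * k : ℝ)⁻¹) ^ k) ^ J := by gcongr
      _ = (1 - (2 * k : ℝ)⁻¹) ^ (J * k) := by rw [← pow_mul, Nat.mul_comm]
      _ ≤ (1 - (2 * k : ℝ)⁻¹) ^ (e.erase u).card :=
        pow_le_pow_of_le_one (by linarith) (by simp)
          ((Finset.card_le_card (Finset.erase_subset u e)).trans h2)
      _ = ∏ w ∈ e.erase u, (1 - (2 * k : ℝ)⁻¹) := by rw [Finset.prod_const]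
      _ ≤ _ := Finset.prod_le_prod (fun _ _ => by linarith) fun w hw => by
        linarith [(hπ w (Finset.mem_of_mem_erase hw)).2]
  calc (2 * J * 2 ^ J : ℝ)⁻¹ = k * ((2 * (J * k) : ℝ)⁻¹ * (1 / 2) ^ J) := by
        rw [one_div, inv_pow]
        field_simp
    _ ≤ e.card * ((2 * (J * k) : ℝ)⁻¹ * (1 / 2) ^ J) := by gcongr
    _ = ∑ u ∈ e, (2 * (J * k) : ℝ)⁻¹ * (1 / 2) ^ J := by rw [Finset.sum_const, nsmul_eq_mul]
    _ ≤ uniqueProb e π := Finset.sum_le_sum fun u hu =>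
      mul_le_mul (hπ u hu).1 (hprod u hu) (by positivity)
        ((inv_nonneg.2 (by positivity)).trans (hπ u hu).1)

lemma failProb_le_pow {π : ℕ → ℕ → ℝ} {δ : ℝ} (hπ : ∀ c u, 0 ≤ π c u ∧ π c u ≤ 1)
    (h : ∀ c ∈ C, δ ≤ uniqueProb e (π c)) : failProb e C π ≤ (1 - δ) ^ C.card := by
  rw [← Finset.prod_const]
  exact Finset.prod_le_prod (fun c _ => sub_nonneg.2 (uniqueProb_le_one (hπ c)))
    fun c hc => by linarith [h c hc]

/-- Some factor differs from `1`, hence some summand of its `uniqueProb` is nonzero. For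
probabilities `0` and `1` this exhibits a colour held exactly once. -/
lemma exists_unique_of_failProb_ne_one {π : ℕ → ℕ → ℝ} (h : failProb e C π ≠ 1) :
    ∃ c ∈ C, ∃ u ∈ e, π c u ≠ 0 ∧ ∀ w ∈ e, w ≠ u → π c w ≠ 1 := by
  obtain ⟨c, hc, h⟩ := Finset.exists_ne_one_of_prod_ne_one h
  obtain ⟨u, hu, h⟩ := Finset.exists_ne_zero_of_sum_ne_zero fun h0 : uniqueProb e (π c) = 0 =>
    h (by rw [h0, sub_zero])
  refine ⟨c, hc, u, hu, left_ne_zero_of_mul h, fun w hw hwu h1 => ?_⟩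
  refine right_ne_zero_of_mul h (Finset.prod_eq_zero (Finset.mem_erase.2 ⟨hwu, hw⟩) ?_)
  rw [h1, sub_self]

end Prob

/-! ### Greedy conflict-free multicolouring -/

section Greedy

/-- The colours that `u` has chosen, if it has been processed. -/
def chosen (x : ℕ → Option (Role × Option (Finset ℕ))) (u : ℕ) : Option (Finset ℕ) :=
  (x u).bind Prod.snd

/-- The least degree of a neighbour. -/
noncomputable def minNbrDegree (adj : ℕ → ℕ → Prop) (u : ℕ) : ℕ :=
  sInf {k | ∃ e, adj u e ∧ k = {w | adj e w}.ncard}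

open Classical in
/-- The probability that `u` gets colour `c`, given the choices made so far. -/
noncomputable def colourProb (adj : ℕ → ℕ → Prop) (x : ℕ → Option (Role × Option (Finset ℕ)))
    (c u : ℕ) : ℝ :=
  match chosen x u with
  | none => (2 * minNbrDegree adj u : ℝ)⁻¹
  | some A => if c ∈ A then 1 else 0

open Classical in
/-- The neighbours of `e`. -/
noncomputable def nbrs (M : ℕ) (adj : ℕ → ℕ → Prop) (e : ℕ) : Finset ℕ :=
  (Finset.range M).filter fun u => adj e u

/-- Choosing the set `A` of colours at `v` does not increase the expected number of failures. -/
def IsGoodChoice (M m : ℕ) (adj : ℕ → ℕ → Prop) (x : ℕ → Option (Role × Option (Finset ℕ)))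
    (v : ℕ) (A : Finset ℕ) : Prop :=
  A ⊆ Finset.Icc 1 m ∧
    ∑ e ∈ nbrs M adj v, failProb (nbrs M adj e) (Finset.Icc 1 m) (commit (colourProb adj x) v A) ≤
      ∑ e ∈ nbrs M adj v, failProb (nbrs M adj e) (Finset.Icc 1 m) (colourProb adj x)

open Classical in
/-- A good choice of colours, together with the additional colour `m + 1`. -/
noncomputable def greedyChoice (M m : ℕ) (adj : ℕ → ℕ → Prop)
    (x : ℕ → Option (Role × Option (Finset ℕ))) (v : ℕ) : Finset ℕ :=
  insert (m + 1) (Classical.epsilon (IsGoodChoice M m adj x v))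

lemma isLocal_colourProb (c : ℕ) : IsLocal 1 fun adj x => colourProb adj x c := by
  intro adj adj' x x' v h
  have h1 : minNbrDegree adj v = minNbrDegree adj' v := by
    unfold minNbrDegree
    congr 1
    ext k
    refine exists_congr fun e => ?_
    rw [← h.adj_iff e]
    refine and_congr_right fun he => ?_
    simp only [(h e (mem_ball_one_of_adj he)).2]
  simp only [colourProb, chosen, h.label, h1]

/-- Incident hyperedges are at distance `1`, their vertices at distance `2`, and the degrees that
fix the probabilities of those vertices are read off at distance `3`. -/
lemma isLocal_greedyChoice (M m : ℕ) : IsLocal 3 (greedyChoice M m) := by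
  classical
  intro adj adj' x x' v h
  have hn : ∀ e ∈ ball adj 1 v, nbrs M adj e = nbrs M adj' e := fun e he =>
    Finset.filter_congr fun u _ => (h e (ball_mono (by omega) he)).2 u
  have hmem : ∀ e ∈ nbrs M adj v, e ∈ ball adj 1 v := fun e he =>
    mem_ball_one_of_adj (Finset.mem_filter.1 he).2
  have hp : ∀ c, ∀ u ∈ ball adj 2 v, colourProb adj x c u = colourProb adj' x' c u :=
    fun c u hu => isLocal_colourProb c (Agree.of_mem (s := 2) h hu)
  have hp' : ∀ e ∈ nbrs M adj v, ∀ c, ∀ u ∈ nbrs M adj e,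
      colourProb adj x c u = colourProb adj' x' c u := fun e he c u hu =>
    hp c u (mem_ball_succ_of_adj (hmem e he) (Finset.mem_filter.1 hu).2)
  unfold greedyChoice
  congr 2
  ext A
  unfold IsGoodChoice
  rw [← hn v mem_ball_self]
  have e1 : ∑ e ∈ nbrs M adj v, failProb (nbrs M adj e) (Finset.Icc 1 m) (colourProb adj x) =
      ∑ e ∈ nbrs M adj v, failProb (nbrs M adj' e) (Finset.Icc 1 m) (colourProb adj' x') := by
    refine Finset.sum_congr rfl fun e he => ?_
    rw [← hn e (hmem e he)]
    exact failProb_congr fun c _ u hu => hp' e he c u hu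
  have e2 : ∑ e ∈ nbrs M adj v,
        failProb (nbrs M adj e) (Finset.Icc 1 m) (commit (colourProb adj x) v A) =
      ∑ e ∈ nbrs M adj v,
        failProb (nbrs M adj' e) (Finset.Icc 1 m) (commit (colourProb adj' x') v A) := by
    refine Finset.sum_congr rfl fun e he => ?_
    rw [← hn e (hmem e he)]
    refine failProb_congr fun c _ u hu => ?_
    simp only [commit, Function.update_apply, hp' e he c u hu]
  rw [e1, e2]

lemma colourProb_mem (adj : ℕ → ℕ → Prop) (x : ℕ → Option (Role × Option (Finset ℕ))) (c u : ℕ) :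
    0 ≤ colourProb adj x c u ∧ colourProb adj x c u ≤ 1 := by
  unfold colourProb
  cases chosen x u with
  | none =>
    refine ⟨by positivity, ?_⟩
    -- A node without neighbours has `sInf ∅ = 0`, and the inverse is then `0`, still a probability.
    rcases Nat.eq_zero_or_pos (minNbrDegree adj u) with h | h
    · simp [h]
    · refine inv_le_one_of_one_le₀ ?_
      have : (1 : ℝ) ≤ minNbrDegree adj u := by exact_mod_cast h
      linarith
  | some A => dsimp only; split_ifs <;> norm_num

lemma greedyChoice_spec (M m : ℕ) (adj : ℕ → ℕ → Prop)
    (x : ℕ → Option (Role × Option (Finset ℕ))) (v : ℕ) :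
    ∃ A, IsGoodChoice M m adj x v A ∧ greedyChoice M m adj x v = insert (m + 1) A := by
  classical
  have h : ∃ A, IsGoodChoice M m adj x v A :=
    exists_commit_le (nbrs M adj v) (nbrs M adj) _ _ fun c => colourProb_mem adj x c v
  refine ⟨_, Classical.epsilon_spec h, ?_⟩
  unfold greedyChoice
  congr!

end Greedy

/-- The SLOCAL algorithm for conflict-free multicolouring with `m n` colours, besides one additional
colour, on networks with identifiers in `{1, …, n ^ a}`. -/
noncomputable def greedyAlg (a : ℕ) (m : ℕ → ℕ) : SLocalAlg Role (Finset ℕ) where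
  State := Finset ℕ
  locality _ := 4
  process n w := w.apply (greedyChoice (n ^ a + 1) (m n))
  out := id

open Classical in
lemma SLocalAlg.runFrom_induction {V I O : Type} [Fintype V] (A : SLocalAlg I O) (N : Network V I)
    (p : (V → Option A.State) → Prop)
    (hp : ∀ s v, p s → p (Function.update s v
      (some (A.process (Fintype.card V) (N.view (A.locality (Fintype.card V)) s v)))))
    (s : V → Option A.State) (hs : p s) (l : List V) : p (A.runFrom N s l) := by
  induction l generalizing s with
  | nil => exact hs
  | cons v l ih => exact ih _ (hp s v hs)

/-! ### The expected number of failures during an execution -/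

section Analysis
variable {V : Type} [Fintype V] {N : Network V Role} {a m : ℕ}

/-- The labelled graph of a network in which the nodes have states `s`. -/
noncomputable def stateLabel (N : Network V Role) (s : V → Option (Finset ℕ)) :
    ℕ → Option (Role × Option (Finset ℕ)) :=
  N.idLabel fun u => (N.input u, s u)

open Classical in
/-- The identifiers of the hyperedges. -/
noncomputable def hyperedgeIds (N : Network V Role) : Finset ℕ :=
  (Finset.univ.filter fun v => N.input v = Role.hyperedge).image N.ident

/-- The expected number of failures, given the states of the nodes. -/
noncomputable def expectedFailures (M m : ℕ) (N : Network V Role) (s : V → Option (Finset ℕ)) : ℝ :=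
  ∑ e ∈ hyperedgeIds N,
    failProb (nbrs M N.idAdj e) (Finset.Icc 1 m) (colourProb N.idAdj (stateLabel N s))

lemma mem_hyperedgeIds {e : ℕ} :
    e ∈ hyperedgeIds N ↔ ∃ h, N.input h = Role.hyperedge ∧ N.ident h = e := by
  simp [hyperedgeIds]

lemma mem_nbrs (hN : N.IdsOK a) {i j : ℕ} :
    j ∈ nbrs (Fintype.card V ^ a + 1) N.idAdj i ↔ N.idAdj i j := by
  classical
  rw [nbrs, Finset.mem_filter, Finset.mem_range]
  refine and_iff_right_of_imp ?_
  rintro ⟨u, w, _, rfl, rfl⟩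
  exact Nat.lt_succ_of_le (hN.2 w).2

omit [Fintype V] in
lemma colourProb_of_state (hN : Function.Injective N.ident) {s : V → Option (Finset ℕ)} {v : V}
    {A : Finset ℕ} (h : s v = some A) (c : ℕ) :
    colourProb N.idAdj (stateLabel N s) c (N.ident v) = if c ∈ A then 1 else 0 := by
  have h1 : chosen (stateLabel N s) (N.ident v) = some A := by
    rw [chosen, stateLabel, Network.idLabel_ident hN]
    exact h
  simp only [colourProb, h1]

omit [Fintype V] in
lemma colourProb_of_none (hN : Function.Injective N.ident) {s : V → Option (Finset ℕ)} {v : V}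
    (h : s v = none) (c : ℕ) :
    colourProb N.idAdj (stateLabel N s) c (N.ident v) =
      (2 * minNbrDegree N.idAdj (N.ident v) : ℝ)⁻¹ := by
  have h1 : chosen (stateLabel N s) (N.ident v) = none := by
    rw [chosen, stateLabel, Network.idLabel_ident hN]
    exact h
  simp only [colourProb, h1]

-- Processing a vertex changes only the terms of its own hyperedges, whose sum its choice does not
-- increase. Processing a hyperedge node changes no term, since its neighbours are vertices. The
-- extra colour `m + 1` is not among those counted.
open Classical in
lemma expectedFailures_update (hN : N.IdsOK a)
    (hbip : ∀ u w, N.graph.Adj u w → N.input u ≠ N.input w) (s : V → Option (Finset ℕ)) (v : V) :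
    expectedFailures (Fintype.card V ^ a + 1) m N (Function.update s v
      (some (greedyChoice (Fintype.card V ^ a + 1) m N.idAdj (stateLabel N s) (N.ident v)))) ≤
    expectedFailures (Fintype.card V ^ a + 1) m N s := by
  set M := Fintype.card V ^ a + 1 with hM
  obtain ⟨A, ⟨hA, hle⟩, hgreedy⟩ := greedyChoice_spec M m N.idAdj (stateLabel N s) (N.ident v)
  rw [hgreedy]
  set s' := Function.update s v (some (insert (m + 1) A)) with hs'
  set π := colourProb N.idAdj (stateLabel N s) with hπ
  have h1 : ∀ i, failProb (nbrs M N.idAdj i) (Finset.Icc 1 m) (colourProb N.idAdj (stateLabel N s')) =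
      failProb (nbrs M N.idAdj i) (Finset.Icc 1 m) (commit π (N.ident v) A) := by
    intro i
    refine failProb_congr fun c hc j hj => ?_
    obtain ⟨u, w, _, rfl, rfl⟩ := (mem_nbrs hN).1 hj
    by_cases hw : w = v
    · subst hw
      have hcm : c ≠ m + 1 := by rw [Finset.mem_Icc] at hc; omega
      rw [colourProb_of_state hN.1 (A := insert (m + 1) A) (by rw [hs', Function.update_self]),
        commit, Function.update_self]
      simp [hcm]
    · have hsw : s' w = s w := Function.update_of_ne hw _ _
      rw [commit, Function.update_of_ne (hN.1.ne hw), hπ]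
      cases h : s w with
      | none => rw [colourProb_of_none hN.1 h, colourProb_of_none hN.1 (hsw.trans h)]
      | some B => rw [colourProb_of_state hN.1 h, colourProb_of_state hN.1 (hsw.trans h)]
  have h2 : ∀ i, i ∉ nbrs M N.idAdj (N.ident v) →
      failProb (nbrs M N.idAdj i) (Finset.Icc 1 m) (commit π (N.ident v) A) =
        failProb (nbrs M N.idAdj i) (Finset.Icc 1 m) π := by
    intro i hi
    refine failProb_congr fun c _ j hj => ?_
    rw [commit, Function.update_of_ne]
    rintro rfl
    exact hi ((mem_nbrs hN).2 (Network.idAdj_symm ((mem_nbrs hN).1 hj)))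
  unfold expectedFailures
  simp_rw [h1]
  cases hv : N.input v with
  | vertex =>
    have hsub : nbrs M N.idAdj (N.ident v) ⊆ hyperedgeIds N := by
      intro i hi
      obtain ⟨u, w, h, hu, rfl⟩ := (mem_nbrs hN).1 hi
      rw [← hN.1 hu] at h
      have := hbip v w h
      rw [hv] at this
      refine mem_hyperedgeIds.2 ⟨w, ?_, rfl⟩
      cases hw : N.input w with
      | vertex => exact absurd hw.symm this
      | hyperedge => rfl
    rw [← Finset.sum_sdiff hsub, ← Finset.sum_sdiff hsub]
    refine add_le_add (le_of_eq (Finset.sum_congr rfl fun i hi => ?_)) hle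
    exact h2 i (Finset.mem_sdiff.1 hi).2
  | hyperedge =>
    refine le_of_eq (Finset.sum_congr rfl fun i hi => h2 i fun h => ?_)
    obtain ⟨e, he, rfl⟩ := mem_hyperedgeIds.1 hi
    exact hbip v e ((Network.idAdj_ident hN.1).1 ((mem_nbrs hN).1 h)) (hv.trans he.symm)

lemma nbrs_ident (hN : N.IdsOK a) (h : V) :
    ((nbrs (Fintype.card V ^ a + 1) N.idAdj (N.ident h) : Finset ℕ) : Set ℕ) =
      N.ident '' N.graph.neighborSet h := by
  ext i
  rw [Finset.mem_coe, mem_nbrs hN]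
  constructor
  · rintro ⟨u, w, huw, hu, rfl⟩
    rw [← hN.1 hu] at huw
    exact ⟨w, huw, rfl⟩
  · rintro ⟨w, hw, rfl⟩
    exact ⟨h, w, hw, rfl, rfl⟩

lemma card_nbrs_ident (hN : N.IdsOK a) (h : V) :
    (nbrs (Fintype.card V ^ a + 1) N.idAdj (N.ident h)).card = (N.graph.neighborSet h).ncard := by
  rw [← Set.ncard_coe_finset, nbrs_ident hN, Set.ncard_image_of_injective _ hN.1]

lemma ncard_idAdj_ident (hN : N.IdsOK a) (h : V) :
    {w | N.idAdj (N.ident h) w}.ncard = (N.graph.neighborSet h).ncard := by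
  rw [← card_nbrs_ident hN, ← Set.ncard_coe_finset]
  congr 1
  ext i
  rw [Finset.mem_coe, mem_nbrs hN]
  rfl

lemma expectedFailures_init (hN : N.IdsOK a)
    (hbip : ∀ u w, N.graph.Adj u w → N.input u ≠ N.input w) {k J : ℕ} (hk : 1 ≤ k) (hJ : 1 ≤ J)
    (hsize : ∀ h, N.input h = Role.hyperedge →
      k ≤ (N.graph.neighborSet h).ncard ∧ (N.graph.neighborSet h).ncard ≤ J * k) :
    expectedFailures (Fintype.card V ^ a + 1) m N (fun _ => none) ≤
      Fintype.card V * (1 - (2 * J * 2 ^ J : ℝ)⁻¹) ^ m := by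
  classical
  have hcard : (hyperedgeIds N).card ≤ Fintype.card V :=
    Finset.card_image_le.trans (Finset.card_filter_le _ _)
  have hδ : (2 * J * 2 ^ J : ℝ)⁻¹ ≤ 1 := by
    refine inv_le_one_of_one_le₀ ?_
    have h1 : (1 : ℝ) ≤ J := by exact_mod_cast hJ
    have h2 : (1 : ℝ) ≤ 2 ^ J := one_le_pow₀ (by norm_num)
    nlinarith
  calc expectedFailures (Fintype.card V ^ a + 1) m N (fun _ => none)
      ≤ ∑ e ∈ hyperedgeIds N, (1 - (2 * J * 2 ^ J : ℝ)⁻¹) ^ m := by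
        refine Finset.sum_le_sum fun e he => ?_
        obtain ⟨h, hh, rfl⟩ := mem_hyperedgeIds.1 he
        refine (failProb_le_pow (δ := (2 * J * 2 ^ J : ℝ)⁻¹) (colourProb_mem _ _)
          fun c _ => ?_).trans_eq (by rw [Nat.card_Icc, Nat.add_sub_cancel])
        refine le_uniqueProb hk hJ (by rw [card_nbrs_ident hN]; exact (hsize h hh).1)
          (by rw [card_nbrs_ident hN]; exact (hsize h hh).2) fun i hi => ?_
        obtain ⟨u, w, huw, hu, rfl⟩ := (mem_nbrs hN).1 hi
        rw [← hN.1 hu] at huw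
        rw [colourProb_of_none hN.1 rfl]
        have hne : {k | ∃ e, N.idAdj (N.ident w) e ∧ k = {w | N.idAdj e w}.ncard}.Nonempty :=
          ⟨_, N.ident h, (Network.idAdj_ident hN.1).2 huw.symm, rfl⟩
        obtain ⟨i, ⟨u', h', huh, hu', rfl⟩, hd⟩ := Nat.sInf_mem hne
        rw [← hN.1 hu'] at huh
        have hd' : minNbrDegree N.idAdj (N.ident w) = (N.graph.neighborSet h').ncard :=
          hd.trans (ncard_idAdj_ident hN h')
        -- The graph is bipartite, so a neighbour of a vertex is a hyperedge; hence the least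
        -- neighbour degree lies between `k` and `J * k`.
        have hh' : N.input h' = Role.hyperedge := by
          have h1 := hbip h w huw
          have h2 := hbip w h' huh
          cases h3 : N.input h' with
          | hyperedge => rfl
          | vertex =>
            cases h4 : N.input w with
            | hyperedge => exact absurd (hh.trans h4.symm) h1
            | vertex => exact absurd (h4.trans h3.symm) h2
        obtain ⟨h5, h6⟩ := hsize h' hh'
        rw [hd']
        have hk' : (1 : ℝ) ≤ k := by exact_mod_cast hk
        have h5' : (k : ℝ) ≤ (N.graph.neighborSet h').ncard := by exact_mod_cast h5
        have h6' : ((N.graph.neighborSet h').ncard : ℝ) ≤ J * k := by exact_mod_cast h6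
        have h7 : (0 : ℝ) < (N.graph.neighborSet h').ncard := by linarith
        constructor <;> gcongr
    _ = (hyperedgeIds N).card * (1 - (2 * J * 2 ^ J : ℝ)⁻¹) ^ m := by
        rw [Finset.sum_const, nsmul_eq_mul]
    _ ≤ _ := by
        refine mul_le_mul_of_nonneg_right (by exact_mod_cast hcard) (pow_nonneg (by linarith) _)

/-- When all choices are made, an expectation below `1` with nonnegative terms leaves every term
below `1`. -/
lemma exists_unique_colour (hN : N.IdsOK a) {y : V → Finset ℕ}
    (hy : expectedFailures (Fintype.card V ^ a + 1) m N (fun v => some (y v)) < 1) {h : V}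
    (hh : N.input h = Role.hyperedge) :
    ∃ c, {v | v ∈ N.graph.neighborSet h ∧ c ∈ y v}.ncard = 1 := by
  have hlt := (Finset.single_le_sum (fun e _ => failProb_nonneg (colourProb_mem _ _))
    (mem_hyperedgeIds.2 ⟨h, hh, rfl⟩)).trans_lt hy
  obtain ⟨c, _, i, hi, h1, h2⟩ := exists_unique_of_failProb_ne_one hlt.ne
  obtain ⟨h', u, huh, hh', rfl⟩ := (mem_nbrs hN).1 hi
  rw [← hN.1 hh'] at huh
  refine ⟨c, Set.ncard_eq_one.2 ⟨u, ?_⟩⟩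
  ext w
  constructor
  · rintro ⟨hw, hc⟩
    by_contra hwu
    refine h2 (N.ident w) ((mem_nbrs hN).2 ((Network.idAdj_ident hN.1).2 hw)) (hN.1.ne hwu) ?_
    rw [colourProb_of_state hN.1 (s := fun v => some (y v)) rfl, if_pos hc]
  · rintro rfl
    refine ⟨huh, ?_⟩
    by_contra hc
    exact h1 (by rw [colourProb_of_state hN.1 (s := fun v => some (y v)) rfl, if_neg hc])

end Analysis

lemma greedyAlg_spec {V : Type} [Fintype V] {N : Network V Role} {a : ℕ} {m : ℕ → ℕ}
    (hN : N.IdsOK a) (hbip : ∀ u w, N.graph.Adj u w → N.input u ≠ N.input w) {k J : ℕ}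
    (hk : 1 ≤ k) (hJ : 1 ≤ J)
    (hsize : ∀ h, N.input h = Role.hyperedge →
      k ≤ (N.graph.neighborSet h).ncard ∧ (N.graph.neighborSet h).ncard ≤ J * k)
    (hm : (Fintype.card V : ℝ) * (1 - (2 * J * 2 ^ J : ℝ)⁻¹) ^ m (Fintype.card V) < 1)
    {l : List V} (hl : ∀ v, v ∈ l) :
    ∃ y : V → Finset ℕ,
      (∀ v, ((greedyAlg a m).runFrom N (fun _ => none) l v).map (greedyAlg a m).out = some (y v)) ∧
      (∀ v, (y v).Nonempty ∧ y v ⊆ Finset.Icc 1 (m (Fintype.card V) + 1)) ∧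
      ∀ h, N.input h = Role.hyperedge →
        ∃ c, {v | v ∈ N.graph.neighborSet h ∧ c ∈ y v}.ncard = 1 := by
  classical
  set n := Fintype.card V with hn
  -- The invariant of the execution; the additional colour makes every chosen set nonempty.
  let p : (V → Option (Finset ℕ)) → Prop := fun s =>
    expectedFailures (n ^ a + 1) (m n) N s < 1 ∧
      ∀ v B, s v = some B → B.Nonempty ∧ B ⊆ Finset.Icc 1 (m n + 1)
  have hstep : ∀ s v, p s → p (Function.update s v
      (some (greedyChoice (n ^ a + 1) (m n) N.idAdj (stateLabel N s) (N.ident v)))) := by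
    rintro s v ⟨h1, h2⟩
    refine ⟨(expectedFailures_update hN hbip s v).trans_lt h1, fun u B hB => ?_⟩
    by_cases hu : u = v
    · subst hu
      rw [Function.update_self] at hB
      obtain ⟨A, ⟨hA, _⟩, hgreedy⟩ := greedyChoice_spec (n ^ a + 1) (m n) N.idAdj (stateLabel N s)
        (N.ident u)
      rw [← Option.some.inj hB, hgreedy]
      refine ⟨Finset.insert_nonempty _ _, Finset.insert_subset (Finset.mem_Icc.2 (by omega)) ?_⟩
      exact hA.trans (Finset.Icc_subset_Icc_right (Nat.le_succ _))
    · rw [Function.update_of_ne hu] at hB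
      exact h2 u B hB
  have hp : p ((greedyAlg a m).runFrom N (fun _ => none) l) := by
    refine (greedyAlg a m).runFrom_induction N p (fun s v hs => ?_) _
      ⟨(expectedFailures_init hN hbip hk hJ hsize).trans_lt hm, fun v B h => by cases h⟩ l
    have hproc : (greedyAlg a m).process n (N.view 4 s v) =
        greedyChoice (n ^ a + 1) (m n) N.idAdj (stateLabel N s) (N.ident v) :=
      Network.view_apply hN.1 (isLocal_greedyChoice _ _) s v
    exact (congrArg (fun B : Finset ℕ => p (Function.update s v (some B))) hproc).mpr
      (hstep s v hs)
  have hsome : ∀ v, ∃ B, (greedyAlg a m).runFrom N (fun _ => none) l v = some B := fun v => by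
    rw [← Option.ne_none_iff_exists',
      (greedyAlg a m).runFrom_eq_idRun hN.1 l (s' := fun _ => none) fun _ => rfl]
    exact idRun_ne_none_of_mem _ (Or.inr (List.mem_map_of_mem (hl v)))
  choose y hy using hsome
  have hy' : (greedyAlg a m).runFrom N (fun _ => none) l = fun v => some (y v) := funext hy
  rw [hy'] at hp
  exact ⟨y, fun v => by rw [hy]; rfl, fun v => hp.2 v (y v) rfl,
    fun h hh => exists_unique_colour hN hp.1 hh⟩

lemma exists_mul_pow_lt_one {δ : ℝ} (h0 : 0 < δ) (h1 : δ ≤ 1) :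
    ∃ c : ℕ, ∀ n : ℕ, (n : ℝ) * (1 - δ) ^ (c * (Nat.log 2 n + 1)) < 1 := by
  obtain ⟨c, hc⟩ := exists_pow_lt_of_lt_one (x := (1 / 2 : ℝ)) (by norm_num)
    (show 1 - δ < 1 by linarith)
  refine ⟨c, fun n => ?_⟩
  have hn : (n : ℝ) < 2 ^ (Nat.log 2 n + 1) := by
    exact_mod_cast Nat.lt_pow_succ_log_self (by omega) n
  calc (n : ℝ) * (1 - δ) ^ (c * (Nat.log 2 n + 1))
      ≤ n * (1 / 2) ^ (Nat.log 2 n + 1) := by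
        rw [pow_mul]
        have : 0 ≤ (1 - δ) ^ c := pow_nonneg (by linarith) c
        gcongr
    _ < 2 ^ (Nat.log 2 n + 1) * (1 / 2) ^ (Nat.log 2 n + 1) :=
        mul_lt_mul_of_pos_right hn (by positivity)
    _ = 1 := by rw [← mul_pow]; norm_num

/-- The algorithm counts colours by the number `n + e` of network nodes, but `q` is evaluated at the
number `n` of vertices; a polynomial bound on `e` costs only a constant factor. -/
lemma log_add_le {n e d : ℕ} (hd : 1 ≤ d) (he : e ≤ n ^ d) :
    Nat.log 2 (n + e) ≤ d * (Nat.log 2 n + 1) + 1 := by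
  have h1 : n ≤ 2 ^ (Nat.log 2 n + 1) := (Nat.lt_pow_succ_log_self (by omega) n).le
  have h2 : n ^ d ≤ 2 ^ (d * (Nat.log 2 n + 1)) := by
    rw [Nat.mul_comm, pow_mul]
    exact Nat.pow_le_pow_left h1 d
  have h3 : 2 ^ (Nat.log 2 n + 1) ≤ 2 ^ (d * (Nat.log 2 n + 1)) :=
    Nat.pow_le_pow_right (by omega) (Nat.le_mul_of_pos_left _ hd)
  refine (Nat.log_mono_right (m := 2 ^ (d * (Nat.log 2 n + 1) + 1)) ?_).trans_eq
    (Nat.log_pow (by omega) _)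
  rw [pow_succ]
  omega

lemma IsIncidenceNetwork.ncard_edgeSet {W : Type} [Fintype W] {H : Hypergraph W}
    {G : SimpleGraph W} {x : W → Role} (h : IsIncidenceNetwork H G x) :
    H.vertexSet.ncard + H.edgeSet.ncard = Fintype.card W := by
  rw [h.1, ← h.2.1.image_eq, h.2.1.injOn.ncard_image, ← Nat.card_eq_fintype_card,
    ← Set.ncard_add_ncard_compl {w | x w = Role.vertex}]
  congr 2
  ext w
  simp only [Set.mem_ofPred_eq, Set.mem_compl_iff]
  cases x w <;> simp

/-- Conflict-free multicolouring of almost uniform hypergraphs with logarithmically many colours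
has an SLOCAL algorithm of constant locality. -/
theorem exists_psLocal_conflictFreeProblem (ε : ℝ) (hε : 0 < ε) (d : ℕ) (hd : 1 ≤ d) :
    ∃ C : ℕ, ∀ q : ℕ → ℕ, (∀ n, C * (Nat.log 2 n + 1) ≤ q n) →
      PSLocal (conflictFreeProblem ε d q) := by
  obtain ⟨J, hJ⟩ := exists_nat_ge (1 + ε)
  have hJ1 : (1 : ℝ) ≤ J := by linarith
  have hδ : (2 * J * 2 ^ J : ℝ)⁻¹ ≤ 1 := by
    refine inv_le_one_of_one_le₀ ?_
    have h2 : (1 : ℝ) ≤ 2 ^ J := one_le_pow₀ (by norm_num)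
    nlinarith
  obtain ⟨c, hc⟩ := exists_mul_pow_lt_one (δ := (2 * J * 2 ^ J : ℝ)⁻¹) (by positivity) hδ
  -- With `L` the logarithm of the number of vertices, at most `c * (d * (L + 1) + 2) + 1` colours
  -- occur, including the additional one.
  refine ⟨c * (d + 2) + 1, fun q hq a => ⟨greedyAlg a fun n => c * (Nat.log 2 n + 1),
    IsPolylog.const 4, ?_⟩⟩
  rintro V _ N hN ⟨H, hH, ⟨k, hk, hsize⟩, hcard⟩ l _ hl
  obtain ⟨y, h1, h2, h3⟩ := greedyAlg_spec (m := fun n => c * (Nat.log 2 n + 1)) hN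
    hH.2.2 hk (by exact_mod_cast hJ1 : 1 ≤ J)
    (fun h hh => by
      obtain ⟨h4, h5⟩ := hsize _ (hH.2.1.mapsTo hh)
      refine ⟨h4, ?_⟩
      have h6 : ((N.graph.neighborSet h).ncard : ℝ) ≤ J * k :=
        h5.trans (mul_le_mul_of_nonneg_right hJ (Nat.cast_nonneg k))
      exact_mod_cast h6) (hc _) hl
  refine ⟨y, h1, fun H' hH' => ⟨fun v _ => ⟨(h2 v).1, (h2 v).2.trans ?_⟩, fun e he => ?_⟩⟩
  · refine Finset.Icc_subset_Icc_right (le_trans ?_ (hq _))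
    -- The roles of the nodes determine the vertex set, so the hypergraph of the instance and that
    -- of the solution have equally many vertices.
    rw [hH'.1, ← hH.1, ← hH.ncard_edgeSet]
    have h6 := Nat.mul_le_mul_left c (log_add_le hd hcard)
    set L := Nat.log 2 H.vertexSet.ncard
    calc _ ≤ c * (d * (L + 1) + 1) + c + 1 := by rw [Nat.mul_succ]; omega
      _ ≤ c * (d * (L + 1) + 1) + c + 1 + (2 * c + 1) * L := Nat.le_add_right _ _
      _ = _ := by ring
  · obtain ⟨h, hh, rfl⟩ := hH'.2.1.surjOn he
    exact h3 h hh

end Distrib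

/-- Conflict-free multicolouring is P-SLOCAL-complete. Hardness holds because deterministic network
decomposition gives P-SLOCAL ⊆ P-LOCAL. -/
theorem mainTheorem4 (ε : ℝ) (hε : 0 < ε) (d : ℕ) (hd : 1 ≤ d) :
    ∃ C : ℕ, ∀ q : ℕ → ℕ, (∀ n, C * (Nat.log 2 n + 1) ≤ q n) → Distrib.IsPolylog q →
      Distrib.PSLocalComplete (Distrib.conflictFreeProblem ε d q) := by
  obtain ⟨C, hC⟩ := Distrib.exists_psLocal_conflictFreeProblem ε hε d hd
  exact ⟨C, fun q hq _ => ⟨hC q hq, fun _ hP _ => hP.pLocal⟩⟩
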